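/- Let $G$ be an $n$-dimensional Lie group, $E_1,\dots,E_n$ a basis of its Lie algebra $\mathfrak g$ (bracket of left-invariant vector fields), $[E_i,E_j]=C_{ij}^kE_k$, and $w^i$ the corresponding coordinates on $\mathfrak g$. Repeated indices are summed. Let $\gamma=\frac{\partial}{\partial t}+\gamma^i\frac{\partial}{\partial w^i}$ be a smooth vector field on $\mathbb R\times\mathfrak g$; it represents the left-invariant second-order system $\dot w=\gamma(t,w)$, $w=g^{-1}\dot g$, on $G$. Put $$\lambda_i^j=\tfrac12\Bigl(w^kC_{ki}^j-\frac{\partial\gamma^j}{\partial w^i}\Bigr),\qquad \phi_i^j=-w^kC_{ki}^l\frac{\partial\gamma^j}{\partial w^l}-\gamma^kC_{ik}^j-\gamma(\lambda_i^j)-\lambda_i^k\lambda_k^j .$$ A reduced multiplier matrix for $\gamma$ is a matrix $(k_{ij})$ of smooth functions on $\mathbb R\times\mathfrak g$ with $\det(k_{ij})\neq0$ everywhere, $k_{ij}=k_{ji}$, $\gamma(k_{ij})-k_{mj}\lambda_i^m-k_{im}\lambda_j^m=0$, $k_{mi}\phi_j^m=k_{mj}\phi_i^m$ and $\partial k_{jm}/\partial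 w^i=\partial k_{im}/\partial w^j$. The field $\gamma$ is derivable from an invariant Lagrangian $L$ if $L\in C^\infty(\mathbb R\times TG)$ is left-invariant and regular (nondegenerate fibre Hessian) and its Euler--Lagrange equations are equivalent to the second-order system on $G$ given by $\gamma$. For a smooth function $l$ on $\mathbb R\times\mathfrak g$ let $V_i=\gamma\bigl(\frac{\partial l}{\partial w^i}\bigr)-C_{ji}^k\frac{\partial l}{\partial w^k}w^j$. Cohomology is Lie algebra cohomology with trivial real coefficients. (1) Let $(k_{ij})$ be a reduced multiplier matrix for $\gamma$. There are smooth functions $l$ with $\partial^2l/\partial w^i\partial w^j=k_{ij}$. For each of them $V_i=\mu_{ji}(t)w^j+\nu_i(t)$ with smooth $\mu,\nu$, where for each $t$ the bilinear form $\mu(t)$, with $\mu(t)(E_i,E_j)=\mu_{ij}(t)$, is a $2$-cocycle of $\mathfrak g$, and the class $[\mu(t)]\in H^2(\mathfrak g)$ does not depend on the choice of $l$. (2) Suppose that $[\mu(t)]=0$ for every $t$. Then for every such $l$ there is a smooth curve $\theta$ in $\mathfrak g^*$ with $\mu_{ij}(t)=\theta_k(t)C_{ij}^k$ for all $t$, and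 for every such $\theta$ the form $\xi(t)=\dot\theta(t)+\nu(t)$ is, for each $t$, a $1$-cocycle, so that it defines a class $[\xi(t)]\in H^1(\mathfrak g)$. The curves of classes for two choices of $(l,\theta)$ differ by the derivative $t\mapsto[\dot\eta(t)]$ of a smooth curve $\eta$ of $1$-cocycles. (3) If, in the situation of (2), for some choice of $(l,\theta)$ the classes $[\xi(t)]$ vanish for every $t$, then $\gamma$ is derivable from an invariant Lagrangian $L$, and $L$ can be chosen such that its restriction to $\mathbb R\times\mathfrak g$ has Hessian $(k_{ij})$. (4) Conversely, suppose that $\gamma$ is derivable from an invariant Lagrangian $L$. Then the Hessian $(k_{ij})$ of the restriction of $L$ to $\mathbb R\times\mathfrak g$ is a reduced multiplier matrix for $\gamma$, its classes $[\mu(t)]\in H^2(\mathfrak g)$ all vanish, and for every $l$ with Hessian $(k_{ij})$ there is a $\theta$ as in (2) for which the classes $[\xi(t)]\in H^1(\mathfrak g)$ all vanish. -/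

import Mathlib

open scoped Manifold ContDiff

noncomputable section

/-! ### Lie algebra cohomology in degrees one and two -/

section Cohomology

open LieModule.Cohomology

variable (R L M : Type*) [CommRing R] [LieRing L] [LieAlgebra R L] [AddCommGroup M] [Module R M]
  [LieRingModule L M] [LieModule R L M]

/-- The Chevalley–Eilenberg differential from `0`-cochains to `1`-cochains, `(d m) x = ⁅x, m⁆`. -/
def lieD₀₁ : M →ₗ[R] oneCochain R L M where
  toFun m :=
    { toFun := fun x => ⁅x, m⁆
      map_add' := fun x y => by simp
      map_smul' := fun r x => by simp }
  map_add' m m' := by ext x; simp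
  map_smul' r m := by ext x; simp

/-- `1`-cocycles. -/
abbrev LieZ1 : Submodule R (oneCochain R L M) := LinearMap.ker (d₁₂ R L M)

/-- The first cohomology group: `1`-cocycles modulo `1`-coboundaries. -/
abbrev LieH1 : Type _ := LieZ1 R L M ⧸ (LinearMap.range (lieD₀₁ R L M)).submoduleOf (LieZ1 R L M)

/-- `2`-cocycles. -/
abbrev LieZ2 : Submodule R (twoCochain R L M) := twoCocycle R L M

/-- The additive group of `2`-cocycles (an instance that is not found automatically). -/
instance instAddCommGroupTwoCocycle : AddCommGroup (twoCocycle R L M) :=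
  Submodule.addCommGroup (R := R) (M := twoCochain R L M) (twoCocycle R L M)

/-- The second cohomology group: `2`-cocycles modulo `2`-coboundaries. -/
abbrev LieH2 : Type _ := LieZ2 R L M ⧸ (LinearMap.range (d₁₂ R L M)).submoduleOf (LieZ2 R L M)

end Cohomology

/-- The trivial one-dimensional real representation of a Lie algebra. -/
abbrev TrivR (𝔤 : Type*) : Type := TrivialLieModule ℝ 𝔤 ℝ

/-- The real number underlying an element of the trivial representation. -/
abbrev TrivR.val {𝔤 : Type*} (x : TrivR 𝔤) : ℝ := TrivialLieModule.equiv ℝ 𝔤 ℝ x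

/-! ### Calculus on `ℝ × ℝⁿ`, with coordinates `(t, wⁱ)` -/

section Reduced

variable {n : ℕ}

/-- The partial derivative `∂f/∂wⁱ`. -/
def pdw (i : Fin n) (f : ℝ × (Fin n → ℝ) → ℝ) (p : ℝ × (Fin n → ℝ)) : ℝ :=
  fderiv ℝ f p (0, Pi.single i 1)

/-- The derivative of `f` along the vector field `∂/∂t + γⁱ ∂/∂wⁱ`. -/
def fieldDeriv (γ : Fin n → ℝ × (Fin n → ℝ) → ℝ) (f : ℝ × (Fin n → ℝ) → ℝ)
    (p : ℝ × (Fin n → ℝ)) : ℝ :=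
  fderiv ℝ f p (1, fun i => γ i p)

/-- The Hessian matrix `∂²l/∂wⁱ∂wʲ`. -/
def hessian (l : ℝ × (Fin n → ℝ) → ℝ) (p : ℝ × (Fin n → ℝ)) : Matrix (Fin n) (Fin n) ℝ :=
  Matrix.of fun i j => pdw i (pdw j l) p

/-- The functions `λᵢʲ = ½ (wᵏ Cₖᵢʲ - ∂γʲ/∂wⁱ)`. -/
def lam (C : Fin n → Fin n → Fin n → ℝ) (γ : Fin n → ℝ × (Fin n → ℝ) → ℝ) (i j : Fin n)
    (p : ℝ × (Fin n → ℝ)) : ℝ :=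
  (1 / 2 : ℝ) * ((∑ k, p.2 k * C k i j) - pdw i (γ j) p)

/-- The functions `φᵢʲ = - wᵏ Cₖᵢˡ ∂γʲ/∂wˡ - γᵏ Cᵢₖʲ - γ(λᵢʲ) - λᵢᵏ λₖʲ`. -/
def phi (C : Fin n → Fin n → Fin n → ℝ) (γ : Fin n → ℝ × (Fin n → ℝ) → ℝ) (i j : Fin n)
    (p : ℝ × (Fin n → ℝ)) : ℝ :=
  -(∑ k, ∑ l, p.2 k * C k i l * pdw l (γ j) p) - (∑ k, γ k p * C i k j)
    - fieldDeriv γ (lam C γ i j) p - ∑ k, lam C γ i k p * lam C γ k j p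

/-- The reduced Helmholtz conditions: `k` is a reduced multiplier matrix for the vector field
`∂/∂t + γⁱ ∂/∂wⁱ`, where `C` are the structure constants. -/
structure IsReducedMultiplier (C : Fin n → Fin n → Fin n → ℝ)
    (γ : Fin n → ℝ × (Fin n → ℝ) → ℝ)
    (k : ℝ × (Fin n → ℝ) → Matrix (Fin n) (Fin n) ℝ) : Prop where
  smooth : ∀ i j, ContDiff ℝ ∞ (fun p => k p i j)
  det_ne_zero : ∀ p, (k p).det ≠ 0
  symm : ∀ p i j, k p i j = k p j i
  deriv_field : ∀ p i j, fieldDeriv γ (fun q => k q i j) p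
      - (∑ m, k p m j * lam C γ i m p) - (∑ m, k p i m * lam C γ j m p) = 0
  phi_symm : ∀ p i j, ∑ m, k p m i * phi C γ j m p = ∑ m, k p m j * phi C γ i m p
  deriv_symm : ∀ p i j m, pdw i (fun q => k q j m) p = pdw j (fun q => k q i m) p

/-- `l` is a smooth function whose Hessian in the variables `wⁱ` is the matrix `k`. -/
def IsPotential (k : ℝ × (Fin n → ℝ) → Matrix (Fin n) (Fin n) ℝ)
    (l : ℝ × (Fin n → ℝ) → ℝ) : Prop :=
  ContDiff ℝ ∞ l ∧ ∀ p, hessian l p = k p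

/-- The Euler–Poincaré expressions `Vᵢ = γ(∂l/∂wⁱ) - Cⱼᵢᵏ (∂l/∂wᵏ) wʲ`. -/
def eulerPoincare (C : Fin n → Fin n → Fin n → ℝ) (γ : Fin n → ℝ × (Fin n → ℝ) → ℝ)
    (l : ℝ × (Fin n → ℝ) → ℝ) (i : Fin n) (p : ℝ × (Fin n → ℝ)) : ℝ :=
  fieldDeriv γ (pdw i l) p - ∑ j, ∑ k, C j i k * pdw k l p * p.2 j

variable {𝔤 : Type*} [LieRing 𝔤] [LieAlgebra ℝ 𝔤]

/-- The structure constants: `⁅Eᵢ, Eⱼ⁆ = Cᵢⱼᵏ Eₖ`. -/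
def structureConstants (b : Module.Basis (Fin n) ℝ 𝔤) (i j k : Fin n) : ℝ := b.repr ⁅b i, b j⁆ k

open LieModule.Cohomology

/-- A smooth curve of `1`-cochains. -/
def SmoothOneCurve (θ : ℝ → oneCochain ℝ 𝔤 (TrivR 𝔤)) : Prop :=
  ∀ x, ContDiff ℝ ∞ (fun t => (θ t x).val)

/-- The Euler–Poincaré expressions of `l` are `Vᵢ(t, w) = μⱼᵢ(t) wʲ + νᵢ(t)`, with smooth curves
`μ` of `2`-cocycles and `ν` of `1`-cochains. -/
structure IsResidual (b : Module.Basis (Fin n) ℝ 𝔤) (γ : Fin n → ℝ × (Fin n → ℝ) → ℝ)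
    (l : ℝ × (Fin n → ℝ) → ℝ) (μ : ℝ → LieZ2 ℝ 𝔤 (TrivR 𝔤))
    (ν : ℝ → oneCochain ℝ 𝔤 (TrivR 𝔤)) : Prop where
  smooth_two : ∀ x y, ContDiff ℝ ∞ (fun t => ((μ t).1 x y).val)
  smooth_one : SmoothOneCurve ν
  eq : ∀ i t w, eulerPoincare (structureConstants b) γ l i (t, w)
    = (∑ j, ((μ t).1 (b j) (b i)).val * w j) + (ν t (b i)).val

/-- `c` is the family `t ↦ [μ(t)]` of classes in `H²(𝔤)` defined by the matrix `k`: it is obtained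
from every function `l` with Hessian `k`. -/
def IsH2Class (b : Module.Basis (Fin n) ℝ 𝔤) (γ : Fin n → ℝ × (Fin n → ℝ) → ℝ)
    (k : ℝ × (Fin n → ℝ) → Matrix (Fin n) (Fin n) ℝ) (c : ℝ → LieH2 ℝ 𝔤 (TrivR 𝔤)) : Prop :=
  ∀ l, IsPotential k l → ∃ μ ν, IsResidual b γ l μ ν ∧ ∀ t, Submodule.Quotient.mk (μ t) = c t

/-- `θ` is a smooth curve with `μ(t)(x, y) = θ(t)(⁅x, y⁆)`, i.e. `μᵢⱼ = θₖ Cᵢⱼᵏ`. -/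
def IsPrimitive (μ : ℝ → LieZ2 ℝ 𝔤 (TrivR 𝔤)) (θ : ℝ → oneCochain ℝ 𝔤 (TrivR 𝔤)) : Prop :=
  SmoothOneCurve θ ∧ ∀ t x y, (μ t).1 x y = θ t ⁅x, y⁆

/-- `c` is the family of classes in `H¹(𝔤)` of the `1`-cocycles `ξ = dθ/dt + ν`. -/
def IsH1Class (ν θ : ℝ → oneCochain ℝ 𝔤 (TrivR 𝔤)) (c : ℝ → LieH1 ℝ 𝔤 (TrivR 𝔤)) : Prop :=
  ∃ ξ : ℝ → LieZ1 ℝ 𝔤 (TrivR 𝔤),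
    (∀ t x, ((ξ t).1 x).val = deriv (fun s => (θ s x).val) t + (ν t x).val) ∧
    ∀ t, Submodule.Quotient.mk (ξ t) = c t

end Reduced

/-! ### Invariant Lagrangians on a Lie group -/

instance instLEInftyMinSmoothnessThree : ENat.LEInfty (minSmoothness ℝ 3) :=
  ⟨by
    rw [minSmoothness_of_isRCLikeNormedField]
    exact ENat.LEInfty.out⟩

section Lagrangian

variable {n : ℕ} {G : Type*} [TopologicalSpace G] [ChartedSpace (EuclideanSpace ℝ (Fin n)) G]

/-- A time-dependent Lagrangian in the coordinates `(x, v)` on the tangent bundle that are induced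
by the chart of `G` at `g₀`. -/
def chartLagrangian (L : ℝ → TangentBundle (𝓡 n) G → ℝ) (g₀ : G) (t : ℝ)
    (x v : EuclideanSpace ℝ (Fin n)) : ℝ :=
  L t ⟨(extChartAt (𝓡 n) g₀).symm x,
    mfderiv 𝓘(ℝ, EuclideanSpace ℝ (Fin n)) (𝓡 n) (extChartAt (𝓡 n) g₀).symm x v⟩

/-- The Euler–Lagrange equations `d/dt (∂L/∂v) = ∂L/∂x` of `L` hold for the curve `c` at time `t₀`,
in the coordinates at the point `c t₀`. -/
def EulerLagrangeAt (L : ℝ → TangentBundle (𝓡 n) G → ℝ) (c : ℝ → G) (t₀ : ℝ) : Prop :=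
  let q : ℝ → EuclideanSpace ℝ (Fin n) := fun t => extChartAt (𝓡 n) (c t₀) (c t)
  HasDerivAt (fun t => fderiv ℝ (fun v => chartLagrangian L (c t₀) t (q t) v) (deriv q t))
    (fderiv ℝ (fun x => chartLagrangian L (c t₀) t₀ x (deriv q t₀)) (q t₀)) t₀

variable [Group G]

/-- A time-dependent Lagrangian on `ℝ × TG` that is smooth, invariant under left translations, and
regular: its second derivative along each tangent space is nondegenerate at every point. -/
structure IsRegularInvariantLagrangian [IsManifold (𝓡 n) ∞ G]
    (L : ℝ → TangentBundle (𝓡 n) G → ℝ) : Prop where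
  smooth : ContMDiff (𝓘(ℝ, ℝ).prod (𝓡 n).tangent) 𝓘(ℝ, ℝ) ∞
    (fun p : ℝ × TangentBundle (𝓡 n) G => L p.1 p.2)
  invariant : ∀ (t : ℝ) (g : G) (v : TangentBundle (𝓡 n) G),
    L t (tangentMap (𝓡 n) (𝓡 n) (fun h => g * h) v) = L t v
  regular : ∀ (t : ℝ) (g : G) (v u : EuclideanSpace ℝ (Fin n)),
    (∀ u', fderiv ℝ (fderiv ℝ (fun v' : EuclideanSpace ℝ (Fin n) => L t ⟨g, v'⟩)) v u u' = 0) →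
      u = 0

/-- The coordinates of `c(t)⁻¹ ċ(t)` with respect to the basis `b` of the Lie algebra. -/
def reducedVelocity (b : Module.Basis (Fin n) ℝ (GroupLieAlgebra (𝓡 n) G)) (c : ℝ → G) (t : ℝ) :
    Fin n → ℝ :=
  let v : TangentSpace (𝓡 n) (c t) := mfderiv 𝓘(ℝ, ℝ) (𝓡 n) c t (1 : ℝ)
  let w : GroupLieAlgebra (𝓡 n) G := mfderiv (𝓡 n) (𝓡 n) (fun h => (c t)⁻¹ * h) (c t) v
  fun i => b.repr w i

/-- The invariant second-order system on `G` with reduced vector field `∂/∂t + γⁱ ∂/∂wⁱ` holds for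
the curve `c` at time `t₀`: `dwⁱ/dt = γⁱ(t, w)` for `w = c⁻¹ ċ`. -/
def InvariantSystemAt (b : Module.Basis (Fin n) ℝ (GroupLieAlgebra (𝓡 n) G))
    (γ : Fin n → ℝ × (Fin n → ℝ) → ℝ) (c : ℝ → G) (t₀ : ℝ) : Prop :=
  HasDerivAt (reducedVelocity b c) (fun i => γ i (t₀, reducedVelocity b c t₀)) t₀

/-- The reduced vector field `∂/∂t + γⁱ ∂/∂wⁱ` is derivable from the invariant Lagrangian `L`:
`L` is regular and invariant, and its Euler–Lagrange equations are equivalent, as second-order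
equations, to the invariant system that `γ` defines on `G`. -/
structure IsDerivableFrom [IsManifold (𝓡 n) ∞ G]
    (b : Module.Basis (Fin n) ℝ (GroupLieAlgebra (𝓡 n) G))
    (γ : Fin n → ℝ × (Fin n → ℝ) → ℝ) (L : ℝ → TangentBundle (𝓡 n) G → ℝ) : Prop where
  lagrangian : IsRegularInvariantLagrangian L
  equiv : ∀ (c : ℝ → G) (t₀ : ℝ), ContMDiffAt 𝓘(ℝ, ℝ) (𝓡 n) 2 c t₀ →
    (EulerLagrangeAt L c t₀ ↔ InvariantSystemAt b γ c t₀)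

/-- The restriction of `L` to `ℝ × T₁G`, in the coordinates given by the basis `b`. -/
def reducedLagrangian (b : Module.Basis (Fin n) ℝ (GroupLieAlgebra (𝓡 n) G))
    (L : ℝ → TangentBundle (𝓡 n) G → ℝ) (p : ℝ × (Fin n → ℝ)) : ℝ :=
  L p.1 ⟨1, ∑ i, p.2 i • b i⟩

end Lagrangian

end

/-!
Three facts carry the proof.

*The reduced Helmholtz conditions.* A symmetric matrix `k` with symmetric derivatives
`∂kⱼₘ/∂wⁱ` is the Hessian of a function `l`, by Poincaré's lemma in the fibres of `ℝ × 𝔤 → ℝ`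
(`exists_isPotential`). Write `V` for the Euler–Poincaré expressions of `l` and `A` for the matrix
`∂Vᵢ/∂wʲ`. The matrix `A` is skew exactly when `k` satisfies the first-order Helmholtz condition
(`epMat_transpose_iff`), and a vector field with skew derivative is affine (`affine_of_pdw_skew`);
this gives `Vᵢ = μⱼᵢ wʲ + νᵢ`. The derivative of `A` along the field is the sum of the skew part of
`k φ`, which vanishes by the algebraic Helmholtz condition, of the terms of the cocycle identity for
`A` evaluated at `w`, and of the coboundary of `V` (`matDeriv_epMat`, where the Jacobi identity
enters). Since `A` depends on `t` only, the part of this identity that is linear in `w` says that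
`μ` is a `2`-cocycle, and the part at `w = 0` is `dμ/dt (x, y) = -ν([x, y])`, which makes
`dθ/dt + ν` a `1`-cocycle for each primitive `θ` of `μ`. Read backwards, with `V = 0`, the same
identities give the Helmholtz conditions.

*Change of potential.* Two potentials of `k` differ by `αᵢ(t) wⁱ + f(t)`. This changes `μ` by the
coboundary of `α`, and `ν` by `dα/dt` (`IsResidual.shift`). The classes of `μ` are therefore
independent of the potential, and the potential can be corrected to one with `V = 0` exactly when
`μ` has a primitive `θ` with `dθ/dt + ν = 0`. The primitive of a smooth curve of coboundaries can be
chosen smooth because a generalized inverse of the coboundary operator is linear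
(`exists_isPrimitive`).

*Reduction.* A left-invariant Lagrangian is `l` composed with the Maurer–Cartan form of `G`. In a
chart the Maurer–Cartan form is a coframe, whose Maurer–Cartan equation turns the Euler–Lagrange
equations into the Euler–Poincaré equations of `l` (`eulerLagrange_iff_eulerPoincare`). Every
`(t, w, dw/dt)` occurs along a curve in `G`, so with a nondegenerate Hessian the system given by
`γ` is equivalent to these equations exactly when `V = 0`
(`isDerivableFrom_invariantLagrangian_iff`).
-/

noncomputable section

/-! ### Smooth dependence of integrals on parameters -/

section ParametricIntegral

open MeasureTheory Set

variable {E F : Type*} [NormedAddCommGroup E] [NormedSpace ℝ E] [FiniteDimensional ℝ E]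
  [NormedAddCommGroup F] [NormedSpace ℝ F]

theorem hasFDerivAt_intervalIntegral_of_contDiff {f : E × ℝ → F} (hf : ContDiff ℝ 1 f) (a b : ℝ)
    (x : E) :
    HasFDerivAt (fun y => ∫ s in a..b, f (y, s))
      (∫ s in a..b, (fderiv ℝ f (x, s)).comp (ContinuousLinearMap.inl ℝ E ℝ)) x := by
  have hcont : Continuous fun q : E × ℝ => (fderiv ℝ f q).comp (ContinuousLinearMap.inl ℝ E ℝ) :=
    (hf.continuous_fderiv one_ne_zero).clm_comp continuous_const
  have hK : IsCompact (Metric.closedBall x 1 ×ˢ uIcc a b) :=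
    (isCompact_closedBall x 1).prod isCompact_uIcc
  obtain ⟨M, hM⟩ := hK.exists_bound_of_continuousOn hcont.continuousOn
  refine intervalIntegral.hasFDerivAt_integral_of_dominated_of_fderiv_le
    (F' := fun y s => (fderiv ℝ f (y, s)).comp (ContinuousLinearMap.inl ℝ E ℝ))
    (bound := fun _ => M) (Metric.closedBall_mem_nhds x one_pos) ?_ ?_ ?_ ?_ ?_ ?_
  · exact Filter.Eventually.of_forall fun y =>
      (hf.continuous.comp (by fun_prop : Continuous fun s : ℝ => (y, s))).aestronglyMeasurable
  · exact (hf.continuous.comp (by fun_prop : Continuous fun s : ℝ => (x, s))).intervalIntegrable _ _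
  · exact (hcont.comp (by fun_prop : Continuous fun s : ℝ => (x, s))).aestronglyMeasurable
  · exact Filter.Eventually.of_forall fun s hs y hy => hM (y, s) ⟨hy, uIoc_subset_uIcc hs⟩
  · exact intervalIntegrable_const
  · refine Filter.Eventually.of_forall fun s _ y _ => ?_
    have h1 : HasFDerivAt f (fderiv ℝ f (y, s)) (y, s) :=
      (hf.differentiable one_ne_zero _).hasFDerivAt
    exact h1.comp y (hasFDerivAt_prodMk_left y s)

/-- Differentiation under the integral sign, iterated. The derivative has values in a space that
depends on `E` and `F`, so the induction is over all `F` in the universe of `E`. -/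
theorem contDiff_intervalIntegral_nat {E : Type} [NormedAddCommGroup E] [NormedSpace ℝ E]
    [FiniteDimensional ℝ E] (a b : ℝ) (m : ℕ) :
    ∀ {F : Type} [NormedAddCommGroup F] [NormedSpace ℝ F] {f : E × ℝ → F},
      ContDiff ℝ ∞ f → ContDiff ℝ m (fun y => ∫ s in a..b, f (y, s)) := by
  induction m with
  | zero =>
    intro F _ _ f hf
    have h1 : ContDiff ℝ 1 f := hf.of_le (by exact_mod_cast le_top)
    exact contDiff_zero.2 (continuous_iff_continuousAt.2 fun x =>
      (hasFDerivAt_intervalIntegral_of_contDiff h1 a b x).continuousAt)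
  | succ m ih =>
    intro F _ _ f hf
    have h1 : ContDiff ℝ 1 f := hf.of_le (by exact_mod_cast le_top)
    have hd := hasFDerivAt_intervalIntegral_of_contDiff h1 a b
    refine contDiff_succ_iff_hasFDerivAt.2 ⟨_, ?_, hd⟩
    exact ih (f := fun q => (fderiv ℝ f q).comp (ContinuousLinearMap.inl ℝ E ℝ))
      ((hf.fderiv_right (m := ∞) (by simp)).clm_comp contDiff_const)

theorem contDiff_intervalIntegral {E F : Type} [NormedAddCommGroup E] [NormedSpace ℝ E]
    [FiniteDimensional ℝ E] [NormedAddCommGroup F] [NormedSpace ℝ F] {f : E × ℝ → F}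
    (hf : ContDiff ℝ ∞ f) (a b : ℝ) : ContDiff ℝ ∞ (fun y => ∫ s in a..b, f (y, s)) :=
  contDiff_infty.2 fun m => contDiff_intervalIntegral_nat a b m hf

end ParametricIntegral

/-! ### Calculus in the variables `wⁱ` -/

section Fibre

variable {n : ℕ}

theorem ContDiff.pdw {f : ℝ × (Fin n → ℝ) → ℝ} (hf : ContDiff ℝ ∞ f) (i : Fin n) :
    ContDiff ℝ ∞ (pdw i f) :=
  (hf.fderiv_right (m := ∞) (by simp)).clm_apply contDiff_const

theorem ContDiff.fieldDeriv {γ : Fin n → ℝ × (Fin n → ℝ) → ℝ} (hγ : ∀ i, ContDiff ℝ ∞ (γ i))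
    {f : ℝ × (Fin n → ℝ) → ℝ} (hf : ContDiff ℝ ∞ f) : ContDiff ℝ ∞ (fieldDeriv γ f) :=
  (hf.fderiv_right (m := ∞) (by simp)).clm_apply (contDiff_const.prodMk (contDiff_pi.2 hγ))

theorem ContDiff.differentiableAt_top {f : ℝ × (Fin n → ℝ) → ℝ} (hf : ContDiff ℝ ∞ f)
    (p : ℝ × (Fin n → ℝ)) : DifferentiableAt ℝ f p :=
  hf.differentiable (by simp) p

theorem sum_smul_single (w : Fin n → ℝ) :
    ((0 : ℝ), w) = ∑ i, w i • ((0 : ℝ), (Pi.single i 1 : Fin n → ℝ)) := by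
  ext k
  · simp [Prod.fst_sum]
  · simp [Prod.snd_sum, Finset.sum_apply, Pi.single_apply]

theorem fderiv_vertical (f : ℝ × (Fin n → ℝ) → ℝ) (p : ℝ × (Fin n → ℝ)) (w : Fin n → ℝ) :
    fderiv ℝ f p (0, w) = ∑ i, w i * pdw i f p := by
  rw [sum_smul_single, map_sum]
  simp only [map_smul, smul_eq_mul, pdw]

/-- Poincaré's lemma in the fibres of `ℝ × ℝⁿ → ℝ`: a smooth family of closed `1`-forms on `ℝⁿ`
has a smooth family of primitives. -/
theorem exists_contDiff_pdw_eq {P : Fin n → ℝ × (Fin n → ℝ) → ℝ} (hP : ∀ i, ContDiff ℝ ∞ (P i))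
    (hsymm : ∀ i j p, pdw i (P j) p = pdw j (P i) p) :
    ∃ f, ContDiff ℝ ∞ f ∧ ∀ i p, pdw i f p = P i p := by
  let F : (ℝ × (Fin n → ℝ)) × ℝ → ℝ := fun q => ∑ i, P i (q.1.1, q.2 • q.1.2) * q.1.2 i
  have hF : ContDiff ℝ ∞ F := by
    refine ContDiff.sum fun i _ => ContDiff.mul ((hP i).comp ?_) ?_
    · fun_prop
    · fun_prop
  refine ⟨fun p => ∫ s in (0:ℝ)..1, F (p, s), contDiff_intervalIntegral hF 0 1, fun j p => ?_⟩
  have hF1 : ContDiff ℝ 1 F := hF.of_le (by exact_mod_cast le_top)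
  -- the derivative of the integrand in the direction `wʲ` is that of `s ↦ s Pⱼ(t, s w)`
  have key : ∀ s : ℝ, HasDerivAt (fun s : ℝ => s * P j (p.1, s • p.2))
      ((fderiv ℝ F (p, s)).comp (ContinuousLinearMap.inl ℝ _ ℝ) (0, Pi.single j 1)) s := by
    intro s
    have e1 : HasDerivAt (fun r : ℝ => F (p + r • (0, Pi.single j 1), s))
        ((fderiv ℝ F (p, s)).comp (ContinuousLinearMap.inl ℝ _ ℝ) (0, Pi.single j 1)) 0 := by
      have hl : HasDerivAt (fun r : ℝ => ((p + r • ((0 : ℝ), Pi.single j (1 : ℝ)), s) :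
          (ℝ × (Fin n → ℝ)) × ℝ)) ((0, Pi.single j 1), 0) 0 := by
        refine HasDerivAt.prodMk ?_ (hasDerivAt_const _ _)
        simpa using ((hasDerivAt_id (0 : ℝ)).smul_const
          ((0 : ℝ), (Pi.single j (1 : ℝ) : Fin n → ℝ))).const_add p
      have := (hF1.differentiable one_ne_zero (p, s)).hasFDerivAt
      have h2 := HasFDerivAt.comp_hasDerivAt_of_eq (0 : ℝ) this hl (by simp)
      exact h2
    have hPd : ∀ i, HasFDerivAt (P i) (fderiv ℝ (P i) (p.1, s • p.2)) (p.1, s • p.2) :=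
      fun i => ((hP i).differentiableAt_top _).hasFDerivAt
    have e2 : HasDerivAt (fun r : ℝ => F (p + r • (0, Pi.single j 1), s))
        (∑ i, ((s * pdw j (P i) (p.1, s • p.2)) * p.2 i
          + P i (p.1, s • p.2) * (Pi.single j (1 : ℝ) : Fin n → ℝ) i)) 0 := by
      refine HasDerivAt.fun_sum fun i _ => ?_
      have hb : HasDerivAt (fun r : ℝ => (p.1, s • (p.2 + r • (Pi.single j (1 : ℝ) : Fin n → ℝ))))
          (0, s • Pi.single j 1) 0 := by
        refine (hasDerivAt_const _ _).prodMk (HasDerivAt.const_smul s ?_)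
        simpa using ((hasDerivAt_id (0 : ℝ)).smul_const
          (Pi.single j (1 : ℝ) : Fin n → ℝ)).const_add p.2
      have h1 := HasFDerivAt.comp_hasDerivAt_of_eq (0 : ℝ) (hPd i) hb (by simp)
      have h2 : HasDerivAt (fun r : ℝ => (p.2 + r • (Pi.single j (1 : ℝ) : Fin n → ℝ)) i)
          ((Pi.single j (1 : ℝ) : Fin n → ℝ) i) 0 := by
        simpa using ((hasDerivAt_id (0 : ℝ)).mul_const
          ((Pi.single j (1 : ℝ) : Fin n → ℝ) i)).const_add (p.2 i)
      have h3 := h1.fun_mul h2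
      have e0 : ((0 : ℝ), s • (Pi.single j 1 : Fin n → ℝ)) = s • ((0 : ℝ), Pi.single j 1) := by
        simp
      rw [e0, map_smul] at h3
      simpa [pdw, Function.comp_def] using h3
    rw [e1.unique e2]
    have hb : HasDerivAt (fun r : ℝ => (p.1, r • p.2)) (0, p.2) s := by
      refine (hasDerivAt_const _ _).prodMk ?_
      simpa using (hasDerivAt_id s).smul_const p.2
    have h4 := (hasDerivAt_id s).fun_mul (HasFDerivAt.comp_hasDerivAt s (hPd j) hb)
    refine h4.congr_deriv ?_
    rw [fderiv_vertical, Finset.sum_add_distrib]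
    simp only [hsymm j, id, Function.comp, one_mul, Finset.mul_sum,
      Pi.single_apply, mul_ite, mul_one, mul_zero, Finset.sum_ite_eq', Finset.mem_univ, if_true]
    rw [add_comm]
    congr 1
    exact Finset.sum_congr rfl fun i _ => by ring
  have hd := hasFDerivAt_intervalIntegral_of_contDiff hF1 0 1 p
  have hcont : Continuous fun s : ℝ => (fderiv ℝ F (p, s)).comp (ContinuousLinearMap.inl ℝ _ ℝ) :=
    ((hF1.continuous_fderiv one_ne_zero).comp (by fun_prop)).clm_comp continuous_const
  have : pdw j (fun p => ∫ s in (0:ℝ)..1, F (p, s)) p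
      = (∫ s in (0:ℝ)..1, (fderiv ℝ F (p, s)).comp (ContinuousLinearMap.inl ℝ _ ℝ))
        (0, Pi.single j 1) := by
    rw [pdw, hd.fderiv]
  rw [this, ContinuousLinearMap.intervalIntegral_apply (hcont.intervalIntegrable _ _)]
  rw [intervalIntegral.integral_eq_sub_of_hasDerivAt (fun s _ => key s)
    ((hcont.clm_apply continuous_const).intervalIntegrable _ _)]
  simp

/-- A symmetric matrix with symmetric first derivatives is a Hessian. -/
theorem exists_isPotential {k : ℝ × (Fin n → ℝ) → Matrix (Fin n) (Fin n) ℝ}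
    (smooth : ∀ i j, ContDiff ℝ ∞ (fun p => k p i j)) (symm : ∀ p i j, k p i j = k p j i)
    (deriv_symm : ∀ p i j m, pdw i (fun q => k q j m) p = pdw j (fun q => k q i m) p) :
    ∃ l, IsPotential k l := by
  choose P hP hPd using fun m => exists_contDiff_pdw_eq (P := fun i p => k p i m)
    (fun i => smooth i m) (fun i j p => deriv_symm p i j m)
  obtain ⟨l, hl, hld⟩ := exists_contDiff_pdw_eq hP
    (fun i j p => by rw [hPd, hPd, symm])
  refine ⟨l, hl, fun p => ?_⟩
  ext i j
  rw [hessian, Matrix.of_apply, show pdw j l = P j from funext (hld j), hPd]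

theorem hasFDerivAt_fderiv {f : ℝ × (Fin n → ℝ) → ℝ} (hf : ContDiff ℝ ∞ f)
    (p : ℝ × (Fin n → ℝ)) : HasFDerivAt (fderiv ℝ f) (fderiv ℝ (fderiv ℝ f) p) p :=
  ((hf.fderiv_right (m := ∞) (by simp)).differentiable (by simp) p).hasFDerivAt

theorem fderiv_fderiv_comm {f : ℝ × (Fin n → ℝ) → ℝ} (hf : ContDiff ℝ ∞ f)
    (p u v : ℝ × (Fin n → ℝ)) :
    fderiv ℝ (fderiv ℝ f) p u v = fderiv ℝ (fderiv ℝ f) p v u :=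
  second_derivative_symmetric (fun q => (hf.differentiableAt_top q).hasFDerivAt)
    (hasFDerivAt_fderiv hf p) u v

theorem fderiv_pdw {f : ℝ × (Fin n → ℝ) → ℝ} (hf : ContDiff ℝ ∞ f) (j : Fin n)
    (p v : ℝ × (Fin n → ℝ)) :
    fderiv ℝ (pdw j f) p v = fderiv ℝ (fderiv ℝ f) p v (0, Pi.single j 1) := by
  have h := (hasFDerivAt_fderiv hf p).clm_apply
    (hasFDerivAt_const ((0 : ℝ), (Pi.single j 1 : Fin n → ℝ)) p)
  have h' : HasFDerivAt (pdw j f) _ p := h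
  rw [h'.fderiv]
  simp

theorem pdw_comm {f : ℝ × (Fin n → ℝ) → ℝ} (hf : ContDiff ℝ ∞ f) (i j : Fin n)
    (p : ℝ × (Fin n → ℝ)) : pdw i (pdw j f) p = pdw j (pdw i f) p := by
  rw [pdw, fderiv_pdw hf, fderiv_fderiv_comm hf, ← fderiv_pdw hf]
  rfl

theorem pdw_fieldDeriv {γ : Fin n → ℝ × (Fin n → ℝ) → ℝ} (hγ : ∀ i, ContDiff ℝ ∞ (γ i))
    {f : ℝ × (Fin n → ℝ) → ℝ} (hf : ContDiff ℝ ∞ f) (j : Fin n) (p : ℝ × (Fin n → ℝ)) :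
    pdw j (fieldDeriv γ f) p = fieldDeriv γ (pdw j f) p + ∑ m, pdw j (γ m) p * pdw m f p := by
  have hγp : HasFDerivAt (fun q => ((1 : ℝ), fun i => γ i q))
      ((0 : ℝ × (Fin n → ℝ) →L[ℝ] ℝ).prod (ContinuousLinearMap.pi fun i => fderiv ℝ (γ i) p)) p :=
    (hasFDerivAt_const _ _).prodMk
      (hasFDerivAt_pi.2 fun i => ((hγ i).differentiableAt_top p).hasFDerivAt)
  have h := (hasFDerivAt_fderiv hf p).clm_apply hγp
  have h' : HasFDerivAt (fieldDeriv γ f) _ p := h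
  rw [pdw, h'.fderiv]
  simp only [fieldDeriv, fderiv_pdw hf, add_apply,
    ContinuousLinearMap.comp_apply, ContinuousLinearMap.flip_apply,
    ContinuousLinearMap.prod_apply, zero_apply]
  rw [fderiv_fderiv_comm hf p (0, _), fderiv_vertical, add_comm]
  rfl

end Fibre

/-! ### Derivatives of matrices along the vector field -/

section MatrixDerivative

variable {n : ℕ} {γ : Fin n → ℝ × (Fin n → ℝ) → ℝ}

section Scalar

variable {f g : ℝ × (Fin n → ℝ) → ℝ} {p : ℝ × (Fin n → ℝ)}

theorem fieldDeriv_add (hf : DifferentiableAt ℝ f p) (hg : DifferentiableAt ℝ g p) :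
    fieldDeriv γ (fun q => f q + g q) p = fieldDeriv γ f p + fieldDeriv γ g p := by
  simp [fieldDeriv, fderiv_fun_add hf hg]

theorem fieldDeriv_sub (hf : DifferentiableAt ℝ f p) (hg : DifferentiableAt ℝ g p) :
    fieldDeriv γ (fun q => f q - g q) p = fieldDeriv γ f p - fieldDeriv γ g p := by
  simp [fieldDeriv, fderiv_fun_sub hf hg]

theorem fieldDeriv_mul (hf : DifferentiableAt ℝ f p) (hg : DifferentiableAt ℝ g p) :
    fieldDeriv γ (fun q => f q * g q) p = fieldDeriv γ f p * g p + f p * fieldDeriv γ g p := by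
  simp [fieldDeriv, fderiv_fun_mul hf hg]; ring

theorem fieldDeriv_const_mul (c : ℝ) (hf : DifferentiableAt ℝ f p) :
    fieldDeriv γ (fun q => c * f q) p = c * fieldDeriv γ f p := by
  simp [fieldDeriv, fderiv_const_mul hf]

theorem fieldDeriv_sum {ι : Type*} {s : Finset ι} {F : ι → ℝ × (Fin n → ℝ) → ℝ}
    (hF : ∀ i ∈ s, DifferentiableAt ℝ (F i) p) :
    fieldDeriv γ (fun q => ∑ i ∈ s, F i q) p = ∑ i ∈ s, fieldDeriv γ (F i) p := by
  simp [fieldDeriv, fderiv_fun_sum hF]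

theorem fieldDeriv_snd (k : Fin n) : fieldDeriv γ (fun q => q.2 k) p = γ k p := by
  have h : HasFDerivAt (fun q : ℝ × (Fin n → ℝ) => q.2 k)
      ((ContinuousLinearMap.proj k).comp (ContinuousLinearMap.snd ℝ ℝ (Fin n → ℝ))) p :=
    ((ContinuousLinearMap.proj (R := ℝ) (φ := fun _ : Fin n => ℝ) k).comp
      (ContinuousLinearMap.snd ℝ ℝ (Fin n → ℝ))).hasFDerivAt
  simp [fieldDeriv, h.fderiv]

theorem pdw_add (i : Fin n) (hf : DifferentiableAt ℝ f p) (hg : DifferentiableAt ℝ g p) :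
    pdw i (fun q => f q + g q) p = pdw i f p + pdw i g p := by
  simp [pdw, fderiv_fun_add hf hg]

theorem pdw_sub (i : Fin n) (hf : DifferentiableAt ℝ f p) (hg : DifferentiableAt ℝ g p) :
    pdw i (fun q => f q - g q) p = pdw i f p - pdw i g p := by
  simp [pdw, fderiv_fun_sub hf hg]

theorem pdw_mul (i : Fin n) (hf : DifferentiableAt ℝ f p) (hg : DifferentiableAt ℝ g p) :
    pdw i (fun q => f q * g q) p = pdw i f p * g p + f p * pdw i g p := by
  simp [pdw, fderiv_fun_mul hf hg]; ring

theorem pdw_const_mul (i : Fin n) (c : ℝ) (hf : DifferentiableAt ℝ f p) :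
    pdw i (fun q => c * f q) p = c * pdw i f p := by
  simp [pdw, fderiv_const_mul hf]

theorem pdw_sum {ι : Type*} {s : Finset ι} {F : ι → ℝ × (Fin n → ℝ) → ℝ} (i : Fin n)
    (hF : ∀ k ∈ s, DifferentiableAt ℝ (F k) p) :
    pdw i (fun q => ∑ k ∈ s, F k q) p = ∑ k ∈ s, pdw i (F k) p := by
  simp [pdw, fderiv_fun_sum hF]

theorem pdw_snd (i k : Fin n) :
    pdw i (fun q => q.2 k) p = (Pi.single i (1 : ℝ) : Fin n → ℝ) k := by
  have h : HasFDerivAt (fun q : ℝ × (Fin n → ℝ) => q.2 k)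
      ((ContinuousLinearMap.proj k).comp (ContinuousLinearMap.snd ℝ ℝ (Fin n → ℝ))) p :=
    ((ContinuousLinearMap.proj (R := ℝ) (φ := fun _ : Fin n => ℝ) k).comp
      (ContinuousLinearMap.snd ℝ ℝ (Fin n → ℝ))).hasFDerivAt
  simp [pdw, h.fderiv]

end Scalar

/-- The entrywise derivative of a matrix of functions along the field `∂/∂t + γⁱ ∂/∂wⁱ`. -/
def matDeriv (γ : Fin n → ℝ × (Fin n → ℝ) → ℝ)
    (M : ℝ × (Fin n → ℝ) → Matrix (Fin n) (Fin n) ℝ) (p : ℝ × (Fin n → ℝ)) :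
    Matrix (Fin n) (Fin n) ℝ :=
  Matrix.of fun i j => fieldDeriv γ (fun q => M q i j) p

variable {M N : ℝ × (Fin n → ℝ) → Matrix (Fin n) (Fin n) ℝ} {p : ℝ × (Fin n → ℝ)}

/-- All entries of a matrix of functions are differentiable at `p`. -/
def MatDiffAt (M : ℝ × (Fin n → ℝ) → Matrix (Fin n) (Fin n) ℝ) (p : ℝ × (Fin n → ℝ)) : Prop :=
  ∀ i j, DifferentiableAt ℝ (fun q => M q i j) p

theorem MatDiffAt.add (hM : MatDiffAt M p) (hN : MatDiffAt N p) :
    MatDiffAt (fun q => M q + N q) p := fun i j => (hM i j).fun_add (hN i j)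

theorem MatDiffAt.sub (hM : MatDiffAt M p) (hN : MatDiffAt N p) :
    MatDiffAt (fun q => M q - N q) p := fun i j => (hM i j).fun_sub (hN i j)

theorem MatDiffAt.mul (hM : MatDiffAt M p) (hN : MatDiffAt N p) :
    MatDiffAt (fun q => M q * N q) p := fun i j => by
  simp only [Matrix.mul_apply]
  exact DifferentiableAt.fun_sum fun k _ => (hM i k).fun_mul (hN k j)

theorem MatDiffAt.transpose (hM : MatDiffAt M p) : MatDiffAt (fun q => (M q).transpose) p :=
  fun i j => hM j i

theorem matDeriv_add (hM : MatDiffAt M p) (hN : MatDiffAt N p) :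
    matDeriv γ (fun q => M q + N q) p = matDeriv γ M p + matDeriv γ N p := by
  ext i j
  exact fieldDeriv_add (hM i j) (hN i j)

theorem matDeriv_sub (hM : MatDiffAt M p) (hN : MatDiffAt N p) :
    matDeriv γ (fun q => M q - N q) p = matDeriv γ M p - matDeriv γ N p := by
  ext i j
  exact fieldDeriv_sub (hM i j) (hN i j)

theorem matDeriv_mul (hM : MatDiffAt M p) (hN : MatDiffAt N p) :
    matDeriv γ (fun q => M q * N q) p = matDeriv γ M p * N p + M p * matDeriv γ N p := by
  ext i j
  simp only [matDeriv, Matrix.of_apply, Matrix.mul_apply, Matrix.add_apply]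
  rw [fieldDeriv_sum fun k _ => (hM i k).fun_mul (hN k j), ← Finset.sum_add_distrib]
  exact Finset.sum_congr rfl fun k _ => fieldDeriv_mul (hM i k) (hN k j)

theorem matDeriv_transpose :
    matDeriv γ (fun q => (M q).transpose) p = (matDeriv γ M p).transpose := rfl

end MatrixDerivative

/-! ### The Euler–Poincaré expressions and the reduced Helmholtz conditions -/

section Helmholtz

open Matrix

variable {n : ℕ} (C : Fin n → Fin n → Fin n → ℝ) (γ : Fin n → ℝ × (Fin n → ℝ) → ℝ)

/-- The matrix of `ad u`, with columns indexed by the argument. -/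
def adMat (u : Fin n → ℝ) : Matrix (Fin n) (Fin n) ℝ := of fun m i => ∑ k, u k * C k i m

/-- The matrix `(i, j) ↦ f(⁅Eⱼ, Eᵢ⁆)` of the coboundary of a covector `f`. -/
def coboundaryMat (f : Fin n → ℝ) : Matrix (Fin n) (Fin n) ℝ := of fun i j => ∑ k, C j i k * f k

/-- The matrix with entry `λᵢʲ` in row `j` and column `i`. -/
def lamMat (p : ℝ × (Fin n → ℝ)) : Matrix (Fin n) (Fin n) ℝ := of fun m i => lam C γ i m p

/-- The matrix with entry `φᵢʲ` in row `j` and column `i`. -/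
def phiMat (p : ℝ × (Fin n → ℝ)) : Matrix (Fin n) (Fin n) ℝ := of fun m i => phi C γ i m p

/-- The derivative of `γ` in the variables `wⁱ`. -/
def gammaMat (p : ℝ × (Fin n → ℝ)) : Matrix (Fin n) (Fin n) ℝ := of fun m i => pdw i (γ m) p

/-- The derivatives `∂Vᵢ/∂wʲ` of the Euler–Poincaré expressions. -/
def epMat (l : ℝ × (Fin n → ℝ) → ℝ) (p : ℝ × (Fin n → ℝ)) : Matrix (Fin n) (Fin n) ℝ :=
  of fun i j => pdw j (eulerPoincare C γ l i) p

/-- The identities satisfied by the structure constants of a Lie algebra. -/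
structure IsLieConstants : Prop where
  skew : ∀ i j k, C i j k = -C j i k
  jacobi : ∀ r i j m, ∑ k, C j i k * C r k m = ∑ k, C r j k * C k i m + ∑ k, C r i k * C j k m

variable {C γ}

theorem gammaMat_eq (p : ℝ × (Fin n → ℝ)) :
    gammaMat γ p = adMat C p.2 - (lamMat C γ p + lamMat C γ p) := by
  ext m i
  simp only [gammaMat, adMat, lamMat, lam, of_apply, Matrix.sub_apply, Matrix.add_apply]
  ring

theorem phiMat_eq (hC : IsLieConstants C) (p : ℝ × (Fin n → ℝ)) :
    phiMat C γ p = -(gammaMat γ p * adMat C p.2) + adMat C (fun k => γ k p)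
      - matDeriv γ (lamMat C γ) p - lamMat C γ p * lamMat C γ p := by
  ext m i
  simp only [phiMat, phi, gammaMat, adMat, lamMat, matDeriv, of_apply, Matrix.sub_apply,
    Matrix.add_apply, Matrix.neg_apply, Matrix.mul_apply, Finset.mul_sum]
  rw [Finset.sum_comm]
  have h1 : ∑ k, γ k p * C i k m = -∑ k, γ k p * C k i m := by
    rw [← Finset.sum_neg_distrib]
    exact Finset.sum_congr rfl fun k _ => by rw [hC.skew i k]; ring
  rw [h1, sub_neg_eq_add]
  congr 3
  · congr 1
    exact Finset.sum_congr rfl fun a _ => Finset.sum_congr rfl fun b _ => by ring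
  · exact funext fun a => by ring

theorem coboundaryMat_transpose (hC : IsLieConstants C) (f : Fin n → ℝ) :
    (coboundaryMat C f)ᵀ = -coboundaryMat C f := by
  ext i j
  simp only [coboundaryMat, transpose_apply, Matrix.neg_apply, of_apply, ← Finset.sum_neg_distrib]
  exact Finset.sum_congr rfl fun k _ => by rw [hC.skew i j]; ring

theorem coboundaryMat_add (f g : Fin n → ℝ) :
    coboundaryMat C (f + g) = coboundaryMat C f + coboundaryMat C g := by
  ext i j
  simp [coboundaryMat, mul_add, Finset.sum_add_distrib]

/-- The Jacobi identity, as a formula for the coboundary of `f ∘ ad u`. -/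
theorem coboundaryMat_ad (hC : IsLieConstants C) (u f : Fin n → ℝ) :
    coboundaryMat C (fun k => ∑ m, adMat C u m k * f m)
      = coboundaryMat C f * adMat C u + (adMat C u)ᵀ * coboundaryMat C f := by
  ext i j
  have e1 : ∀ k, ∑ m, adMat C u m k * f m = ∑ r, ∑ m, u r * f m * C r k m := fun k => by
    simp only [adMat, of_apply, Finset.sum_mul]
    rw [Finset.sum_comm]
    exact Finset.sum_congr rfl fun a _ => Finset.sum_congr rfl fun b _ => by ring
  have lhs : ∑ k, C j i k * ∑ r, ∑ m, u r * f m * C r k m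
      = ∑ r, ∑ m, u r * f m * ∑ k, C j i k * C r k m := by
    simp only [Finset.mul_sum]
    rw [Finset.sum_comm]
    refine Finset.sum_congr rfl fun a _ => ?_
    rw [Finset.sum_comm]
    exact Finset.sum_congr rfl fun b _ => Finset.sum_congr rfl fun c _ => by ring
  have r1 : ∑ k, (∑ m, C k i m * f m) * ∑ r, u r * C r j k
      = ∑ r, ∑ m, u r * f m * ∑ k, C r j k * C k i m := by
    simp only [Finset.mul_sum, Finset.sum_mul]
    rw [Finset.sum_comm]
    refine Finset.sum_congr rfl fun a _ => ?_
    rw [Finset.sum_comm]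
    exact Finset.sum_congr rfl fun b _ => Finset.sum_congr rfl fun c _ => by ring
  have r2 : ∑ k, (∑ r, u r * C r i k) * ∑ m, C j k m * f m
      = ∑ r, ∑ m, u r * f m * ∑ k, C r i k * C j k m := by
    simp only [Finset.mul_sum, Finset.sum_mul]
    rw [Finset.sum_comm_cycle]
    refine Finset.sum_congr rfl fun a _ => ?_
    rw [Finset.sum_comm]
    exact Finset.sum_congr rfl fun b _ => Finset.sum_congr rfl fun c _ => by ring
  simp only [coboundaryMat, of_apply, Matrix.add_apply, Matrix.mul_apply, transpose_apply, e1, lhs]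
  simp only [adMat, of_apply, r1, r2]
  rw [← Finset.sum_add_distrib]
  refine Finset.sum_congr rfl fun a _ => ?_
  rw [← Finset.sum_add_distrib]
  exact Finset.sum_congr rfl fun b _ => by rw [hC.jacobi]; ring

variable {l : ℝ × (Fin n → ℝ) → ℝ}

theorem hessian_apply_comm (hl : ContDiff ℝ ∞ l) (i j : Fin n) :
    (fun q => hessian l q i j) = pdw j (pdw i l) :=
  funext fun q => pdw_comm hl i j q

theorem hessian_transpose (hl : ContDiff ℝ ∞ l) (p : ℝ × (Fin n → ℝ)) :
    (hessian l p)ᵀ = hessian l p := by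
  ext i j
  exact pdw_comm hl j i p

theorem contDiff_eulerPoincare (hγ : ∀ i, ContDiff ℝ ∞ (γ i)) (hl : ContDiff ℝ ∞ l) (i : Fin n) :
    ContDiff ℝ ∞ (eulerPoincare C γ l i) := by
  refine ContDiff.sub (ContDiff.fieldDeriv hγ (hl.pdw i)) ?_
  refine ContDiff.sum fun j _ => ContDiff.sum fun k _ => ?_
  exact (contDiff_const.mul (hl.pdw k)).mul (by fun_prop)

theorem differentiableAt_snd_apply (k : Fin n) (p : ℝ × (Fin n → ℝ)) :
    DifferentiableAt ℝ (fun q : ℝ × (Fin n → ℝ) => q.2 k) p := by fun_prop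

theorem epMat_eq (hγ : ∀ i, ContDiff ℝ ∞ (γ i)) (hl : ContDiff ℝ ∞ l) (p : ℝ × (Fin n → ℝ)) :
    epMat C γ l p = matDeriv γ (hessian l) p + hessian l p * gammaMat γ p
      - coboundaryMat C (fun k => pdw k l p) - (adMat C p.2)ᵀ * hessian l p := by
  ext i j
  have hd : ∀ a k, DifferentiableAt ℝ (fun q : ℝ × (Fin n → ℝ) => C a i k * pdw k l q) p :=
    fun a k => ((hl.pdw k).differentiableAt_top p).const_mul _
  have hd' : ∀ a k, DifferentiableAt ℝ
      (fun q : ℝ × (Fin n → ℝ) => C a i k * pdw k l q * q.2 a) p :=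
    fun a k => (hd a k).fun_mul (differentiableAt_snd_apply a p)
  simp only [epMat, Matrix.of_apply, Matrix.sub_apply, Matrix.add_apply, matDeriv,
    hessian_apply_comm hl, Matrix.mul_apply, transpose_apply, gammaMat, coboundaryMat, adMat]
  unfold eulerPoincare
  rw [pdw_sub j ((ContDiff.fieldDeriv hγ (hl.pdw i)).differentiableAt_top p)
    (DifferentiableAt.fun_sum fun a _ => DifferentiableAt.fun_sum fun k _ => hd' a k),
    pdw_fieldDeriv hγ (hl.pdw i),
    pdw_sum j (fun a _ => DifferentiableAt.fun_sum fun k _ => hd' a k), sub_sub]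
  congr 1
  · congr 1
    refine Finset.sum_congr rfl fun m _ => ?_
    rw [mul_comm, hessian, Matrix.of_apply, pdw_comm hl]
  · have : ∀ a, pdw j (fun q => ∑ k, C a i k * pdw k l q * q.2 a) p
        = ∑ k, (C a i k * pdw j (pdw k l) p * p.2 a
          + C a i k * pdw k l p * (Pi.single j (1 : ℝ) : Fin n → ℝ) a) := fun a => by
      rw [pdw_sum j fun k _ => hd' a k]
      refine Finset.sum_congr rfl fun k _ => ?_
      rw [pdw_mul j (hd a k) (differentiableAt_snd_apply a p),
        pdw_const_mul j _ ((hl.pdw k).differentiableAt_top p), pdw_snd]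
    simp only [this, Finset.sum_add_distrib, Pi.single_apply, mul_ite, mul_one, mul_zero]
    rw [add_comm]
    congr 1
    · rw [Finset.sum_comm]
      simp
    · rw [Finset.sum_comm]
      refine Finset.sum_congr rfl fun k _ => ?_
      rw [Finset.sum_mul]
      refine Finset.sum_congr rfl fun a _ => ?_
      rw [hessian, Matrix.of_apply, pdw_comm hl]
      ring

/-- The Helmholtz condition `γ(kᵢⱼ) = kₘⱼ λᵢᵐ + kᵢₘ λⱼᵐ` in matrix form. -/
def MultiplierTransport (C : Fin n → Fin n → Fin n → ℝ) (γ : Fin n → ℝ × (Fin n → ℝ) → ℝ)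
    (K : ℝ × (Fin n → ℝ) → Matrix (Fin n) (Fin n) ℝ) : Prop :=
  ∀ p, matDeriv γ K p = (lamMat C γ p)ᵀ * K p + K p * lamMat C γ p

theorem multiplierTransport_iff {K : ℝ × (Fin n → ℝ) → Matrix (Fin n) (Fin n) ℝ} :
    MultiplierTransport C γ K ↔ ∀ p i j, fieldDeriv γ (fun q => K q i j) p
      - (∑ m, K p m j * lam C γ i m p) - (∑ m, K p i m * lam C γ j m p) = 0 := by
  refine forall_congr' fun p => ?_
  rw [← Matrix.ext_iff]
  refine forall_congr' fun i => forall_congr' fun j => ?_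
  simp only [matDeriv, of_apply, Matrix.add_apply, Matrix.mul_apply, transpose_apply, lamMat]
  simp only [mul_comm (lam C γ i _ p)]
  constructor <;> intro h <;> linarith

theorem epMat_eq_of_transport (hγ : ∀ i, ContDiff ℝ ∞ (γ i)) (hl : ContDiff ℝ ∞ l)
    (hK : MultiplierTransport C γ (hessian l)) (p : ℝ × (Fin n → ℝ)) :
    epMat C γ l p = (lamMat C γ p)ᵀ * hessian l p - hessian l p * lamMat C γ p
      + hessian l p * adMat C p.2
      - coboundaryMat C (fun k => pdw k l p) - (adMat C p.2)ᵀ * hessian l p := by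
  rw [epMat_eq hγ hl, hK, gammaMat_eq (C := C)]
  noncomm_ring

/-- The matrix `∂Vᵢ/∂wʲ` is skew exactly when the Hessian of `l` satisfies the first-order
Helmholtz condition. -/
theorem epMat_transpose_iff (hC : IsLieConstants C) (hγ : ∀ i, ContDiff ℝ ∞ (γ i))
    (hl : ContDiff ℝ ∞ l) :
    (∀ p, (epMat C γ l p)ᵀ = -epMat C γ l p) ↔ MultiplierTransport C γ (hessian l) := by
  constructor
  · intro h p
    have h1 := h p
    have hT : (matDeriv γ (hessian l) p)ᵀ = matDeriv γ (hessian l) p := by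
      rw [← matDeriv_transpose]
      congr 1
      exact funext fun q => hessian_transpose hl q
    rw [epMat_eq hγ hl, gammaMat_eq (C := C)] at h1
    simp only [transpose_add, transpose_sub, transpose_mul, transpose_transpose,
      hessian_transpose hl, coboundaryMat_transpose hC, hT] at h1
    have h2 : (2 : ℝ) • matDeriv γ (hessian l) p
        = (2 : ℝ) • ((lamMat C γ p)ᵀ * hessian l p + hessian l p * lamMat C γ p) := by
      rw [two_smul, two_smul, ← sub_eq_zero]
      rw [← sub_eq_zero] at h1
      rw [← h1]
      noncomm_ring
    exact smul_right_injective _ two_ne_zero h2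
  · intro hK p
    rw [epMat_eq_of_transport hγ hl hK]
    simp only [transpose_add, transpose_sub, transpose_mul, transpose_transpose,
      hessian_transpose hl, coboundaryMat_transpose hC]
    noncomm_ring

theorem matDiffAt_of_contDiff {M : ℝ × (Fin n → ℝ) → Matrix (Fin n) (Fin n) ℝ}
    (hM : ∀ i j, ContDiff ℝ ∞ fun q => M q i j) (p : ℝ × (Fin n → ℝ)) : MatDiffAt M p :=
  fun i j => (hM i j).differentiableAt_top p

theorem contDiff_adMat (i j : Fin n) :
    ContDiff ℝ ∞ fun q : ℝ × (Fin n → ℝ) => adMat C q.2 i j := by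
  simp only [adMat, of_apply]
  fun_prop

theorem contDiff_lamMat (hγ : ∀ i, ContDiff ℝ ∞ (γ i)) (i j : Fin n) :
    ContDiff ℝ ∞ fun q => lamMat C γ q i j :=
  contDiff_const.mul ((contDiff_adMat (C := C) i j).sub ((hγ i).pdw j))

theorem contDiff_hessian (hl : ContDiff ℝ ∞ l) (i j : Fin n) :
    ContDiff ℝ ∞ fun q => hessian l q i j := (hl.pdw j).pdw i

theorem contDiff_coboundaryMat (hl : ContDiff ℝ ∞ l) (i j : Fin n) :
    ContDiff ℝ ∞ fun q => coboundaryMat C (fun k => pdw k l q) i j := by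
  simp only [coboundaryMat, of_apply]
  exact ContDiff.sum fun k _ => contDiff_const.mul (hl.pdw k)

theorem matDeriv_adMat (p : ℝ × (Fin n → ℝ)) :
    matDeriv γ (fun q => adMat C q.2) p = adMat C (fun k => γ k p) := by
  ext i j
  simp only [matDeriv, adMat, of_apply]
  rw [fieldDeriv_sum fun k _ => (differentiableAt_snd_apply k p).mul_const _]
  refine Finset.sum_congr rfl fun k _ => ?_
  simp only [mul_comm _ (C k j i)]
  rw [fieldDeriv_const_mul _ (differentiableAt_snd_apply k p), fieldDeriv_snd]

theorem fieldDeriv_pdw_eq (i : Fin n) (p : ℝ × (Fin n → ℝ)) :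
    fieldDeriv γ (pdw i l) p = eulerPoincare C γ l i p + ∑ m, adMat C p.2 m i * pdw m l p := by
  rw [eulerPoincare, sub_add, eq_comm, sub_eq_self, sub_eq_zero]
  simp only [adMat, of_apply, Finset.sum_mul]
  rw [Finset.sum_comm]
  exact Finset.sum_congr rfl fun a _ => Finset.sum_congr rfl fun b _ => by ring

theorem matDeriv_coboundaryMat (hC : IsLieConstants C) (hl : ContDiff ℝ ∞ l)
    (p : ℝ × (Fin n → ℝ)) :
    matDeriv γ (fun q => coboundaryMat C (fun k => pdw k l q)) p
      = coboundaryMat C (fun k => eulerPoincare C γ l k p)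
        + (coboundaryMat C (fun k => pdw k l p) * adMat C p.2
          + (adMat C p.2)ᵀ * coboundaryMat C (fun k => pdw k l p)) := by
  rw [← coboundaryMat_ad hC, ← coboundaryMat_add]
  ext i j
  simp only [matDeriv, coboundaryMat, of_apply, Pi.add_apply]
  rw [fieldDeriv_sum fun k _ => ((hl.pdw k).differentiableAt_top p).const_mul _]
  refine Finset.sum_congr rfl fun k _ => ?_
  rw [fieldDeriv_const_mul _ ((hl.pdw k).differentiableAt_top p), fieldDeriv_pdw_eq (C := C)]

/-- The derivative along the field of the matrix `A = (∂Vᵢ/∂wʲ)`. The algebraic Helmholtz condition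
is the symmetry of `K Φ`; the other terms are those of the cocycle identity for `A`, evaluated at
`w`, and the coboundary of `V`. The Jacobi identity cancels all remaining terms. -/
theorem matDeriv_epMat (hC : IsLieConstants C) (hγ : ∀ i, ContDiff ℝ ∞ (γ i))
    (hl : ContDiff ℝ ∞ l) (hK : MultiplierTransport C γ (hessian l)) (p : ℝ × (Fin n → ℝ)) :
    matDeriv γ (epMat C γ l) p
      = hessian l p * phiMat C γ p - (hessian l p * phiMat C γ p)ᵀ
        + (epMat C γ l p * adMat C p.2 + (adMat C p.2)ᵀ * epMat C γ l p
          - coboundaryMat C (fun k => eulerPoincare C γ l k p)) := by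
  have hKd := matDiffAt_of_contDiff (contDiff_hessian hl) p
  have hΛd := matDiffAt_of_contDiff (contDiff_lamMat (C := C) hγ) p
  have hWd := matDiffAt_of_contDiff (contDiff_adMat (C := C)) p
  have hBd := matDiffAt_of_contDiff (contDiff_coboundaryMat (C := C) hl) p
  rw [funext fun q => epMat_eq_of_transport hγ hl hK q,
    matDeriv_sub ((((hΛd.transpose.mul hKd).sub (hKd.mul hΛd)).add (hKd.mul hWd)).sub hBd)
      (hWd.transpose.mul hKd),
    matDeriv_sub (((hΛd.transpose.mul hKd).sub (hKd.mul hΛd)).add (hKd.mul hWd)) hBd,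
    matDeriv_add ((hΛd.transpose.mul hKd).sub (hKd.mul hΛd)) (hKd.mul hWd),
    matDeriv_sub (hΛd.transpose.mul hKd) (hKd.mul hΛd),
    matDeriv_mul hΛd.transpose hKd, matDeriv_mul hKd hΛd, matDeriv_mul hKd hWd,
    matDeriv_mul hWd.transpose hKd, matDeriv_transpose, matDeriv_transpose, matDeriv_adMat,
    matDeriv_coboundaryMat hC hl, hK, phiMat_eq hC,
    gammaMat_eq (C := C)]
  simp only [transpose_add, transpose_sub, transpose_mul, transpose_neg, hessian_transpose hl]
  noncomm_ring

end Helmholtz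

/-! ### Cochains in coordinates -/

section Cochains

open LieModule.Cohomology Matrix

variable {n : ℕ} {𝔤 : Type*} [LieRing 𝔤] [LieAlgebra ℝ 𝔤] (b : Module.Basis (Fin n) ℝ 𝔤)

theorem lie_basis_eq_sum (i j : Fin n) :
    ⁅b i, b j⁆ = ∑ k, structureConstants b i j k • b k :=
  (b.sum_repr _).symm

theorem isLieConstants_structureConstants : IsLieConstants (structureConstants b) where
  skew i j k := by
    rw [structureConstants, ← lie_skew, map_neg, Finsupp.neg_apply]
    rfl
  jacobi r i j m := by
    have h := congrArg (fun x => b.repr x m) (leibniz_lie (b r) (b j) (b i))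
    simp only [map_add, Finsupp.add_apply, lie_basis_eq_sum b j i, lie_basis_eq_sum b r j,
      lie_basis_eq_sum b r i, lie_sum, sum_lie, lie_smul, smul_lie, map_sum, map_smul,
      Finsupp.finsetSum_apply, Finsupp.smul_apply, smul_eq_mul] at h
    exact h

variable {b}

theorem TrivR.val_injective {𝔤 : Type*} : Function.Injective (TrivR.val : TrivR 𝔤 → ℝ) :=
  (TrivialLieModule.equiv ℝ 𝔤 ℝ).injective

theorem TrivR.val_zero {𝔤 : Type*} : (0 : TrivR 𝔤).val = 0 := rfl

theorem TrivR.val_neg {𝔤 : Type*} (x : TrivR 𝔤) : (-x).val = -x.val := rfl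

theorem TrivR.val_add {𝔤 : Type*} (x y : TrivR 𝔤) : (x + y).val = x.val + y.val := rfl

variable (b) in
/-- The `1`-cochain with given values on a basis. -/
def oneForm (f : Fin n → ℝ) : oneCochain ℝ 𝔤 (TrivR 𝔤) :=
  b.constr ℝ fun i => (TrivialLieModule.equiv ℝ 𝔤 ℝ).symm (f i)

@[simp]
theorem oneForm_basis (f : Fin n → ℝ) (i : Fin n) : (oneForm b f (b i)).val = f i := by
  simp [oneForm]

variable (b) in
/-- The bilinear form `(Eⱼ, Eᵢ) ↦ Aᵢⱼ` with values in the trivial representation. -/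
def bilinForm (A : Matrix (Fin n) (Fin n) ℝ) : 𝔤 →ₗ[ℝ] 𝔤 →ₗ[ℝ] TrivR 𝔤 :=
  b.constr ℝ fun j => oneForm b fun i => A i j

@[simp]
theorem bilinForm_basis (A : Matrix (Fin n) (Fin n) ℝ) (i j : Fin n) :
    (bilinForm b A (b j) (b i)).val = A i j := by
  simp [bilinForm]

theorem oneCochain_ext {f g : oneCochain ℝ 𝔤 (TrivR 𝔤)}
    (h : ∀ i, (f (b i)).val = (g (b i)).val) : f = g :=
  b.ext fun i => TrivR.val_injective (h i)

theorem bilin_ext {f g : 𝔤 →ₗ[ℝ] 𝔤 →ₗ[ℝ] TrivR 𝔤}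
    (h : ∀ i j, (f (b j) (b i)).val = (g (b j) (b i)).val) : f = g :=
  b.ext fun j => b.ext fun i => TrivR.val_injective (h i j)

theorem val_oneCochain_apply (f : oneCochain ℝ 𝔤 (TrivR 𝔤)) (x : 𝔤) :
    (f x).val = ∑ i, b.repr x i * (f (b i)).val := by
  conv_lhs => rw [← b.sum_repr x]
  simp only [map_sum, map_smul, smul_eq_mul]

theorem val_lie_basis (f : oneCochain ℝ 𝔤 (TrivR 𝔤)) (i j : Fin n) :
    (f ⁅b i, b j⁆).val = ∑ k, structureConstants b i j k * (f (b k)).val :=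
  val_oneCochain_apply f _

theorem val_bilin_apply (f : 𝔤 →ₗ[ℝ] 𝔤 →ₗ[ℝ] TrivR 𝔤) (x y : 𝔤) :
    (f x y).val = ∑ j, ∑ i, b.repr x j * (b.repr y i * (f (b j) (b i)).val) := by
  conv_lhs => rw [← b.sum_repr x, ← b.sum_repr y]
  simp only [map_sum, map_smul, smul_eq_mul, LinearMap.sum_apply, LinearMap.smul_apply,
    Finset.mul_sum]
  rw [Finset.sum_comm]
  exact Finset.sum_congr rfl fun j _ => Finset.sum_congr rfl fun i _ => by ring

theorem bilin_eq_sum (f : 𝔤 →ₗ[ℝ] 𝔤 →ₗ[ℝ] TrivR 𝔤) :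
    f = ∑ j, ∑ i, (f (b j) (b i)).val • bilinForm b (Matrix.single i j 1) := by
  refine bilin_ext (b := b) fun i j => ?_
  simp only [LinearMap.sum_apply, LinearMap.smul_apply, map_sum, map_smul, bilinForm_basis,
    smul_eq_mul, Matrix.single_apply]
  rw [Finset.sum_eq_single j, Finset.sum_eq_single i] <;> simp +contextual

/-- The `2`-cocycle defined by a skew matrix that satisfies the cocycle identity. -/
theorem exists_twoCocycle_of_matrix {A : Matrix (Fin n) (Fin n) ℝ} (hA : Aᵀ = -A)
    (hcoc : ∀ i j r, ∑ m, A i m * structureConstants b r j m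
      + ∑ m, structureConstants b r i m * A m j = ∑ k, structureConstants b j i k * A k r) :
    ∃ μ : LieZ2 ℝ 𝔤 (TrivR 𝔤), ∀ i j, (μ.1 (b j) (b i)).val = A i j := by
  have hskew : bilinForm b A = -(bilinForm b A).flip := by
    refine bilin_ext (b := b) fun i j => ?_
    have := congrFun (congrFun hA j) i
    simp only [transpose_apply, Matrix.neg_apply] at this
    simp [this]
  have halt : ∀ x, bilinForm b A x x = 0 := fun x => by
    have h : bilinForm b A x x = -bilinForm b A x x := by
      conv_lhs => rw [hskew]
      simp
    have h' := congrArg TrivR.val h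
    rw [TrivR.val_neg] at h'
    exact TrivR.val_injective (self_eq_neg.1 h')
  let a : twoCochain ℝ 𝔤 (TrivR 𝔤) := ⟨bilinForm b A, halt⟩
  refine ⟨⟨a, ?_⟩, fun i j => bilinForm_basis A i j⟩
  rw [mem_twoCocycle_iff]
  refine b.ext fun r => b.ext fun j => b.ext fun i => TrivR.val_injective ?_
  have h1 : ∀ x y, a x y = bilinForm b A x y := fun _ _ => rfl
  have hl : ∀ i j k, (bilinForm b A ⁅b i, b j⁆ (b k)).val
      = ∑ m, structureConstants b i j m * A k m := fun i j k => by
    have := val_lie_basis (b := b) ((bilinForm b A).flip (b k)) i j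
    simpa only [LinearMap.flip_apply, bilinForm_basis] using this
  rw [d₂₃_apply]
  simp only [trivial_lie_zero, h1, map_add, map_sub, LinearMap.zero_apply, map_zero, hl]
  have hs : ∀ i j, A i j = -A j i := fun i j => by
    have := congrFun (congrFun hA j) i
    simpa using this
  have e1 := hcoc i j r
  have e2 : ∑ m, structureConstants b r i m * A m j = -∑ m, structureConstants b r i m * A j m := by
    rw [← Finset.sum_neg_distrib]
    exact Finset.sum_congr rfl fun m _ => by rw [hs m j]; ring
  have e3 : ∑ k, structureConstants b j i k * A k r = -∑ k, structureConstants b j i k * A r k := by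
    rw [← Finset.sum_neg_distrib]
    exact Finset.sum_congr rfl fun m _ => by rw [hs m r]; ring
  simp only [mul_comm (A i _)] at e1
  linarith

theorem mem_LieZ1_iff {f : oneCochain ℝ 𝔤 (TrivR 𝔤)} :
    f ∈ LieZ1 ℝ 𝔤 (TrivR 𝔤) ↔ ∀ x y : 𝔤, f ⁅x, y⁆ = 0 := by
  rw [LinearMap.mem_ker]
  constructor
  · intro h x y
    have : d₁₂ ℝ 𝔤 (TrivR 𝔤) f x y = 0 := by rw [h]; rfl
    rwa [d₁₂_apply_apply_ofTrivial, neg_eq_zero] at this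
  · intro h
    refine DFunLike.ext _ _ fun x => LinearMap.ext fun y => ?_
    rw [d₁₂_apply_apply_ofTrivial, h, neg_zero]
    rfl

variable (b) in
theorem mem_LieZ1_of_basis {f : oneCochain ℝ 𝔤 (TrivR 𝔤)} (h : ∀ i j, (f ⁅b j, b i⁆).val = 0) :
    f ∈ LieZ1 ℝ 𝔤 (TrivR 𝔤) := by
  rw [LinearMap.mem_ker]
  refine Subtype.ext (bilin_ext (b := b) fun i j => ?_)
  have : (d₁₂ ℝ 𝔤 (TrivR 𝔤) f).1 (b j) (b i) = -f ⁅b j, b i⁆ :=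
    d₁₂_apply_apply_ofTrivial _ _ _ f _ _
  rw [this, TrivR.val_neg, h, neg_zero]
  rfl

/-- With trivial coefficients a class in `H¹` is a cocycle. -/
theorem LieH1_mk_eq_mk_iff {ξ ξ' : LieZ1 ℝ 𝔤 (TrivR 𝔤)} :
    (Submodule.Quotient.mk ξ : LieH1 ℝ 𝔤 (TrivR 𝔤)) = Submodule.Quotient.mk ξ' ↔ ξ = ξ' := by
  rw [Submodule.Quotient.eq, Submodule.submoduleOf, Submodule.mem_comap]
  constructor
  · rintro ⟨m, hm⟩
    have h0 : lieD₀₁ ℝ 𝔤 (TrivR 𝔤) m = 0 := by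
      ext x
      exact trivial_lie_zero 𝔤 (TrivR 𝔤) x m
    rw [h0] at hm
    exact sub_eq_zero.1 (Subtype.ext hm.symm)
  · rintro rfl
    simp

/-- The coboundary of a `1`-cochain, as a `2`-cocycle. -/
def coboundary₂ : oneCochain ℝ 𝔤 (TrivR 𝔤) →ₗ[ℝ] LieZ2 ℝ 𝔤 (TrivR 𝔤) :=
  (d₁₂ ℝ 𝔤 (TrivR 𝔤)).codRestrict (twoCocycle ℝ 𝔤 (TrivR 𝔤)) fun f =>
    (mem_twoCocycle_iff _ _ _ _).2 (LinearMap.congr_fun (d₂₃_comp_d₁₂ ℝ 𝔤 (TrivR 𝔤)) f)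

theorem coboundary₂_apply (f : oneCochain ℝ 𝔤 (TrivR 𝔤)) (x y : 𝔤) :
    (coboundary₂ f).1 x y = -f ⁅x, y⁆ := d₁₂_apply_apply_ofTrivial _ _ _ f x y

theorem LieH2_mk_eq_mk_iff {μ μ' : LieZ2 ℝ 𝔤 (TrivR 𝔤)} :
    (Submodule.Quotient.mk μ : LieH2 ℝ 𝔤 (TrivR 𝔤)) = Submodule.Quotient.mk μ' ↔
      ∃ f, μ = μ' + coboundary₂ f := by
  rw [Submodule.Quotient.eq, Submodule.submoduleOf, Submodule.mem_comap]
  constructor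
  · rintro ⟨f, hf⟩
    exact ⟨f, by rw [← sub_eq_iff_eq_add']; exact Subtype.ext hf.symm⟩
  · rintro ⟨f, rfl⟩
    exact ⟨f, by rw [add_sub_cancel_left]; rfl⟩

end Cochains

/-! ### Smooth curves of cochains -/

section Curves

open LieModule.Cohomology Matrix

variable {n : ℕ} {𝔤 : Type*} [LieRing 𝔤] [LieAlgebra ℝ 𝔤] {b : Module.Basis (Fin n) ℝ 𝔤}
  {α β θ : ℝ → oneCochain ℝ 𝔤 (TrivR 𝔤)}

theorem SmoothOneCurve.differentiableAt (hα : SmoothOneCurve α) (x : 𝔤) (t : ℝ) :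
    DifferentiableAt ℝ (fun s => (α s x).val) t := (hα x).differentiable (by simp) t

theorem SmoothOneCurve.add (hα : SmoothOneCurve α) (hβ : SmoothOneCurve β) :
    SmoothOneCurve fun t => α t + β t := fun x => (hα x).add (hβ x)

theorem SmoothOneCurve.sub (hα : SmoothOneCurve α) (hβ : SmoothOneCurve β) :
    SmoothOneCurve fun t => α t - β t := fun x => (hα x).sub (hβ x)

theorem SmoothOneCurve.neg (hα : SmoothOneCurve α) : SmoothOneCurve fun t => -α t :=
  fun x => (hα x).neg

theorem smoothOneCurve_of_basis (h : ∀ i, ContDiff ℝ ∞ fun t => (α t (b i)).val) :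
    SmoothOneCurve α := fun x => by
  simp only [val_oneCochain_apply (b := b) _ x]
  exact ContDiff.sum fun i _ => contDiff_const.mul (h i)

theorem contDiff_two_of_basis {μ : ℝ → LieZ2 ℝ 𝔤 (TrivR 𝔤)}
    (h : ∀ i j, ContDiff ℝ ∞ fun t => ((μ t).1 (b j) (b i)).val) (x y : 𝔤) :
    ContDiff ℝ ∞ fun t => ((μ t).1 x y).val := by
  have : ∀ t, ((μ t).1 x y).val
      = ∑ j, ∑ i, b.repr x j * (b.repr y i * ((μ t).1 (b j) (b i)).val) := fun t =>
    val_bilin_apply (μ t).1.1 x y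
  simp only [this]
  exact ContDiff.sum fun j _ => ContDiff.sum fun i _ =>
    contDiff_const.mul (contDiff_const.mul (h i j))

/-- The velocity of a smooth curve of `1`-cochains. -/
def SmoothOneCurve.velocity (hα : SmoothOneCurve α) (t : ℝ) : oneCochain ℝ 𝔤 (TrivR 𝔤) where
  toFun x := (TrivialLieModule.equiv ℝ 𝔤 ℝ).symm (deriv (fun s => (α s x).val) t)
  map_add' x y := by
    simp only [map_add]
    rw [deriv_fun_add (hα.differentiableAt x t) (hα.differentiableAt y t), map_add]
  map_smul' c x := by
    simp only [map_smul, smul_eq_mul, RingHom.id_apply]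
    rw [deriv_const_mul _ (hα.differentiableAt x t), ← smul_eq_mul, map_smul]

theorem SmoothOneCurve.velocity_apply (hα : SmoothOneCurve α) (t : ℝ) (x : 𝔤) :
    (hα.velocity t x).val = deriv (fun s => (α s x).val) t := rfl

theorem SmoothOneCurve.smooth_velocity (hα : SmoothOneCurve α) : SmoothOneCurve hα.velocity :=
  fun x => (contDiff_infty_iff_deriv.1 (hα x)).2

/-- A linear map has a generalized inverse. -/
theorem exists_generalizedInverse {V W : Type*} [AddCommGroup V] [Module ℝ V] [AddCommGroup W]
    [Module ℝ W] (T : V →ₗ[ℝ] W) : ∃ g : W →ₗ[ℝ] V, ∀ f, T (g (T f)) = T f := by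
  obtain ⟨h, hh⟩ := T.rangeRestrict.exists_rightInverse_of_surjective T.range_rangeRestrict
  obtain ⟨g, hg⟩ := h.exists_extend
  refine ⟨g, fun f => ?_⟩
  have h1 : g (T f) = h (T.rangeRestrict f) := LinearMap.congr_fun hg (T.rangeRestrict f)
  have h2 : T.rangeRestrict (h (T.rangeRestrict f)) = T.rangeRestrict f := LinearMap.congr_fun hh _
  rw [h1]
  exact congrArg Subtype.val h2

/-- A smooth curve of `2`-coboundaries is the coboundary of a smooth curve. -/
theorem exists_isPrimitive (b : Module.Basis (Fin n) ℝ 𝔤) {μ : ℝ → LieZ2 ℝ 𝔤 (TrivR 𝔤)}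
    (hμ : ∀ x y, ContDiff ℝ ∞ fun t => ((μ t).1 x y).val)
    (h0 : ∀ t, (Submodule.Quotient.mk (μ t) : LieH2 ℝ 𝔤 (TrivR 𝔤)) = 0) :
    ∃ θ, IsPrimitive μ θ := by
  -- a linear map that inverts the coboundary operator on its range
  let T : oneCochain ℝ 𝔤 (TrivR 𝔤) →ₗ[ℝ] (𝔤 →ₗ[ℝ] 𝔤 →ₗ[ℝ] TrivR 𝔤) :=
    (twoCochain ℝ 𝔤 (TrivR 𝔤)).subtype.comp (d₁₂ ℝ 𝔤 (TrivR 𝔤))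
  obtain ⟨g, hT⟩ := exists_generalizedInverse T
  refine ⟨fun t => -g (μ t).1.1, fun x => ?_, fun t x y => ?_⟩
  · have : ∀ t, ((-g (μ t).1.1) x).val = -∑ j, ∑ i, ((μ t).1 (b j) (b i)).val *
        (g (bilinForm b (Matrix.single i j 1)) x).val := fun t => by
      conv_lhs => rw [bilin_eq_sum (b := b) (μ t).1.1]
      rw [LinearMap.neg_apply, TrivR.val_neg]
      simp only [map_sum, map_smul, LinearMap.sum_apply, LinearMap.smul_apply, smul_eq_mul]
      rfl
    simp only [this]
    exact (ContDiff.sum fun j _ => ContDiff.sum fun i _ => (hμ _ _).mul contDiff_const).neg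
  · obtain ⟨f, hf⟩ := LieH2_mk_eq_mk_iff (μ' := 0).1 (h0 t)
    rw [zero_add] at hf
    have h1 : (μ t).1.1 = T f := by rw [hf]; rfl
    have h2 := LinearMap.congr_fun (LinearMap.congr_fun (hT f) x) y
    rw [← h1] at h2
    have h3 : T (g (μ t).1.1) x y = -g (μ t).1.1 ⁅x, y⁆ := d₁₂_apply_apply_ofTrivial _ _ _ _ _ _
    rw [h3] at h2
    exact h2.symm

end Curves

/-! ### Residuals of the Euler–Poincaré expressions -/

section Residual

open LieModule.Cohomology Matrix

variable {n : ℕ} {𝔤 : Type*} [LieRing 𝔤] [LieAlgebra ℝ 𝔤] {b : Module.Basis (Fin n) ℝ 𝔤}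
  {γ : Fin n → ℝ × (Fin n → ℝ) → ℝ} {l l' : ℝ × (Fin n → ℝ) → ℝ}
  {μ μ' : ℝ → LieZ2 ℝ 𝔤 (TrivR 𝔤)} {ν ν' : ℝ → oneCochain ℝ 𝔤 (TrivR 𝔤)}

theorem eq_zero_section_of_pdw_eq_zero {f : ℝ × (Fin n → ℝ) → ℝ} (hf : ContDiff ℝ ∞ f)
    (h : ∀ i p, pdw i f p = 0) (t : ℝ) (w : Fin n → ℝ) : f (t, w) = f (t, 0) := by
  have hd : ∀ w, HasFDerivAt (fun w => f (t, w)) (0 : (Fin n → ℝ) →L[ℝ] ℝ) w := fun w => by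
    have h1 := (hf.differentiableAt_top (t, w)).hasFDerivAt.comp w (hasFDerivAt_prodMk_right t w)
    refine h1.congr_fderiv ?_
    ext v
    simp [fderiv_vertical, h]
  exact is_const_of_fderiv_eq_zero (fun w => (hd w).differentiableAt) (fun w => (hd w).fderiv) w 0

/-- A vector field on `ℝⁿ` with skew derivative is affine: its second derivatives `∂ₐ∂ⱼVᵢ` are
symmetric in `a, j` and skew in `i, j`, hence zero. -/
theorem affine_of_pdw_skew {V : Fin n → ℝ × (Fin n → ℝ) → ℝ} (hV : ∀ i, ContDiff ℝ ∞ (V i))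
    (h : ∀ i j p, pdw j (V i) p = -pdw i (V j) p) (t : ℝ) (w : Fin n → ℝ) :
    (∀ i j, pdw j (V i) (t, w) = pdw j (V i) (t, 0)) ∧
      ∀ i, V i (t, w) = ∑ j, pdw j (V i) (t, 0) * w j + V i (t, 0) := by
  have hneg : ∀ a i j p, pdw a (pdw j (V i)) p = -pdw a (pdw i (V j)) p := fun a i j p => by
    rw [show pdw j (V i) = fun q => (-1) * pdw i (V j) q from funext fun q => by rw [h]; ring,
      pdw_const_mul _ _ (((hV j).pdw i).differentiableAt_top p)]
    ring
  have h2 : ∀ a i j p, pdw a (pdw j (V i)) p = 0 := fun a i j p => by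
    have e1 := hneg a i j p
    rw [pdw_comm (hV j) a i, hneg i j a, pdw_comm (hV a) i j, hneg j a i,
      pdw_comm (hV i) j a] at e1
    linarith
  have hc : ∀ t w i j, pdw j (V i) (t, w) = pdw j (V i) (t, 0) := fun t w i j =>
    eq_zero_section_of_pdw_eq_zero ((hV i).pdw j) (fun a p => h2 a i j p) t w
  refine ⟨hc t w, fun i => ?_⟩
  let L : (Fin n → ℝ) →L[ℝ] ℝ := ∑ j, pdw j (V i) (t, 0) • ContinuousLinearMap.proj j
  have hL : ∀ w, L w = ∑ j, pdw j (V i) (t, 0) * w j := fun w => by simp [L]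
  have hd : ∀ w, HasFDerivAt (fun w => V i (t, w) - L w) (0 : (Fin n → ℝ) →L[ℝ] ℝ) w := fun w => by
    have h1 := ((hV i).differentiableAt_top (t, w)).hasFDerivAt.comp w
      (hasFDerivAt_prodMk_right t w)
    refine (h1.sub L.hasFDerivAt).congr_fderiv ?_
    ext v
    simp [fderiv_vertical, hL, hc t w, mul_comm]
  have := is_const_of_fderiv_eq_zero (fun w => (hd w).differentiableAt) (fun w => (hd w).fderiv) w 0
  simp only [hL, Pi.zero_apply, mul_zero, Finset.sum_const_zero, sub_zero] at this
  linarith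

theorem matDeriv_eq_deriv {M : ℝ × (Fin n → ℝ) → Matrix (Fin n) (Fin n) ℝ} {A : ℝ → ℝ} {i j : Fin n}
    (hM : ∀ p, M p i j = A p.1) (hA : ContDiff ℝ ∞ A) (p : ℝ × (Fin n → ℝ)) :
    matDeriv γ M p i j = deriv A p.1 := by
  have h : HasFDerivAt (fun q : ℝ × (Fin n → ℝ) => A q.1) _ p :=
    (hA.differentiable (by simp) p.1).hasDerivAt.hasFDerivAt.comp p hasFDerivAt_fst
  simp only [matDeriv, of_apply, hM, fieldDeriv]
  rw [h.fderiv]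
  simp

theorem IsReducedMultiplier.transport {C : Fin n → Fin n → Fin n → ℝ}
    {k : ℝ × (Fin n → ℝ) → Matrix (Fin n) (Fin n) ℝ} (hk : IsReducedMultiplier C γ k)
    (hl : IsPotential k l) : MultiplierTransport C γ (hessian l) := by
  rw [funext hl.2]
  exact multiplierTransport_iff.2 hk.deriv_field

theorem IsReducedMultiplier.phi_transpose {C : Fin n → Fin n → Fin n → ℝ}
    {k : ℝ × (Fin n → ℝ) → Matrix (Fin n) (Fin n) ℝ} (hk : IsReducedMultiplier C γ k)
    (p : ℝ × (Fin n → ℝ)) : (k p * phiMat C γ p)ᵀ = k p * phiMat C γ p := by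
  ext i j
  simp only [transpose_apply, Matrix.mul_apply, phiMat, of_apply]
  simp only [hk.symm p j, hk.symm p i]
  exact hk.phi_symm p j i

/-- The data read off from the Euler–Poincaré expressions of a potential of a multiplier: they are
affine in `w`, and `∂A/∂t` is given by the cocycle expression and the coboundary of `V`. -/
theorem IsReducedMultiplier.affine (hγ : ∀ i, ContDiff ℝ ∞ (γ i))
    {k : ℝ × (Fin n → ℝ) → Matrix (Fin n) (Fin n) ℝ}
    (hk : IsReducedMultiplier (structureConstants b) γ k) (hl : IsPotential k l) :
    (∀ t w, epMat (structureConstants b) γ l (t, w) = epMat (structureConstants b) γ l (t, 0)) ∧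
    (∀ i t w, eulerPoincare (structureConstants b) γ l i (t, w)
      = ∑ j, epMat (structureConstants b) γ l (t, 0) i j * w j
        + eulerPoincare (structureConstants b) γ l i (t, 0)) ∧
    ∀ p, matDeriv γ (epMat (structureConstants b) γ l) p
      = epMat (structureConstants b) γ l p * adMat (structureConstants b) p.2
        + (adMat (structureConstants b) p.2)ᵀ * epMat (structureConstants b) γ l p
          - coboundaryMat (structureConstants b)
            (fun k => eulerPoincare (structureConstants b) γ l k p) := by
  have hC := isLieConstants_structureConstants b
  have hskew := (epMat_transpose_iff hC hγ hl.1).2 (hk.transport hl)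
  have haff := affine_of_pdw_skew (V := eulerPoincare (structureConstants b) γ l)
    (fun i => contDiff_eulerPoincare hγ hl.1 i)
    (fun i j p => congrFun (congrFun (hskew p) j) i)
  refine ⟨fun t w => ?_, fun i t w => (haff t w).2 i, fun p => ?_⟩
  · ext i j
    exact (haff t w).1 i j
  · rw [matDeriv_epMat hC hγ hl.1 (hk.transport hl), hl.2, hk.phi_transpose, sub_self, zero_add]

/-- The Euler–Poincaré expressions of a potential of a multiplier are affine in `w`, and their
linear part is a `2`-cocycle. -/
theorem IsReducedMultiplier.exists_isResidual (hγ : ∀ i, ContDiff ℝ ∞ (γ i))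
    {k : ℝ × (Fin n → ℝ) → Matrix (Fin n) (Fin n) ℝ}
    (hk : IsReducedMultiplier (structureConstants b) γ k) (hl : IsPotential k l) :
    ∃ μ ν, IsResidual b γ l μ ν := by
  obtain ⟨h1, h2, h3⟩ := hk.affine hγ hl
  have hC := isLieConstants_structureConstants b
  have hskew := (epMat_transpose_iff hC hγ hl.1).2 (hk.transport hl)
  have hVs := fun i => contDiff_eulerPoincare (C := structureConstants b) hγ hl.1 i
  set A := epMat (structureConstants b) γ l
  set V := eulerPoincare (structureConstants b) γ l
  have hAs : ∀ i j, ContDiff ℝ ∞ fun t : ℝ => A (t, 0) i j := fun i j =>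
    ((hVs i).pdw j).comp (contDiff_id.prodMk contDiff_const)
  have hcoc : ∀ t i j r, ∑ m, A (t, 0) i m * structureConstants b r j m
      + ∑ m, structureConstants b r i m * A (t, 0) m j
        = ∑ k, structureConstants b j i k * A (t, 0) k r := by
    intro t i j r
    have hd : ∀ p : ℝ × (Fin n → ℝ), matDeriv γ A p i j = deriv (fun s => A (s, 0) i j) p.1 :=
      matDeriv_eq_deriv (fun p => by rw [← h1 p.1 p.2]) (hAs i j)
    -- `∂A/∂t` does not depend on `w`: comparing its values at `w = 0` and `w = Eᵣ` leaves the
    -- cocycle identity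
    have e0 := congrFun (congrFun (h3 (t, 0)) i) j
    have e1 := congrFun (congrFun (h3 (t, Pi.single r 1)) i) j
    rw [hd] at e0 e1
    simp only [h1 t (Pi.single r 1), Matrix.sub_apply, Matrix.add_apply, Matrix.mul_apply,
      transpose_apply, adMat, of_apply, coboundaryMat, h2 _ t (Pi.single r 1), Pi.single_apply,
      ite_mul, one_mul, zero_mul, mul_ite, mul_one, mul_zero, Finset.sum_ite_eq', Finset.mem_univ,
      if_true, mul_add, Finset.sum_add_distrib, Pi.zero_apply, Finset.sum_const_zero] at e0 e1
    linarith
  choose μ hμ using fun t => exists_twoCocycle_of_matrix (hskew (t, 0)) (hcoc t)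
  refine ⟨μ, fun t => oneForm b fun i => V i (t, 0), ?_, ?_, ?_⟩
  · exact contDiff_two_of_basis (b := b) fun i j => by simp only [hμ]; exact hAs i j
  · exact smoothOneCurve_of_basis (b := b) fun i => by
      simp only [oneForm_basis]
      exact (hVs i).comp (contDiff_id.prodMk contDiff_const)
  · intro i t w
    simp only [hμ, oneForm_basis]
    exact h2 i t w

theorem IsResidual.one_eq (h : IsResidual b γ l μ ν) (i : Fin n) (t : ℝ) :
    (ν t (b i)).val = eulerPoincare (structureConstants b) γ l i (t, 0) := by
  simp [h.eq]

theorem IsResidual.two_eq (h : IsResidual b γ l μ ν) (i j : Fin n) (t : ℝ) :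
    ((μ t).1 (b j) (b i)).val = eulerPoincare (structureConstants b) γ l i (t, Pi.single j 1)
      - eulerPoincare (structureConstants b) γ l i (t, 0) := by
  simp [h.eq, Pi.single_apply]

theorem IsResidual.unique (h : IsResidual b γ l μ ν) (h' : IsResidual b γ l μ' ν') :
    μ = μ' ∧ ν = ν' := by
  constructor
  · funext t
    refine Subtype.ext (Subtype.ext (bilin_ext (b := b) fun i j => ?_))
    exact (h.two_eq i j t).trans (h'.two_eq i j t).symm
  · funext t
    exact oneCochain_ext (b := b) fun i => (h.one_eq i t).trans (h'.one_eq i t).symm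

/-- The curve `μ` of cocycles satisfies `dμ/dt (x, y) = -ν([x, y])`. -/
theorem IsResidual.deriv_two (hγ : ∀ i, ContDiff ℝ ∞ (γ i))
    {k : ℝ × (Fin n → ℝ) → Matrix (Fin n) (Fin n) ℝ}
    (hk : IsReducedMultiplier (structureConstants b) γ k) (hl : IsPotential k l)
    (h : IsResidual b γ l μ ν) (t : ℝ) (i j : Fin n) :
    deriv (fun s => ((μ s).1 (b j) (b i)).val) t = -(ν t ⁅b j, b i⁆).val := by
  obtain ⟨h1, h2, h3⟩ := hk.affine hγ hl
  have hA : ∀ p : ℝ × (Fin n → ℝ), epMat (structureConstants b) γ l p i j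
      = ((μ p.1).1 (b j) (b i)).val := fun p => by
    rw [h.two_eq, h2, ← h1 p.1 p.2]
    simp [Pi.single_apply]
  have e0 := congrFun (congrFun (h3 (t, 0)) i) j
  rw [matDeriv_eq_deriv hA (h.smooth_two _ _)] at e0
  rw [e0, val_lie_basis]
  simp only [Matrix.sub_apply, Matrix.add_apply, Matrix.mul_apply, transpose_apply, adMat, of_apply,
    coboundaryMat, Pi.zero_apply, zero_mul, mul_zero, Finset.sum_const_zero, add_zero, zero_sub,
    h.one_eq]

end Residual

/-! ### Change of potential -/

section Shift

open LieModule.Cohomology Matrix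

variable {n : ℕ} {𝔤 : Type*} [LieRing 𝔤] [LieAlgebra ℝ 𝔤] {b : Module.Basis (Fin n) ℝ 𝔤}
  {γ : Fin n → ℝ × (Fin n → ℝ) → ℝ} {l l' : ℝ × (Fin n → ℝ) → ℝ}
  {k : ℝ × (Fin n → ℝ) → Matrix (Fin n) (Fin n) ℝ}
  {μ μ' : ℝ → LieZ2 ℝ 𝔤 (TrivR 𝔤)} {ν ν' α θ θ' : ℝ → oneCochain ℝ 𝔤 (TrivR 𝔤)}

/-- The fibre derivatives of `l'` and `l` differ by the curve `α` of covectors. Equivalently,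
`l' - l - αᵢ(t) wⁱ` depends on `t` only. -/
structure IsShift (b : Module.Basis (Fin n) ℝ 𝔤) (l l' : ℝ × (Fin n → ℝ) → ℝ)
    (α : ℝ → oneCochain ℝ 𝔤 (TrivR 𝔤)) : Prop where
  smooth : SmoothOneCurve α
  pdw_eq : ∀ i p, pdw i l' p = pdw i l p + (α p.1 (b i)).val

theorem IsPotential.exists_isShift (b : Module.Basis (Fin n) ℝ 𝔤) (hl : IsPotential k l)
    (hl' : IsPotential k l') : ∃ α, IsShift b l l' α := by
  have hs : ∀ i, ContDiff ℝ ∞ fun p => pdw i l' p - pdw i l p := fun i =>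
    (hl'.1.pdw i).sub (hl.1.pdw i)
  refine ⟨fun t => oneForm b fun i => pdw i l' (t, 0) - pdw i l (t, 0), ?_, fun i p => ?_⟩
  · refine smoothOneCurve_of_basis (b := b) fun i => ?_
    simp only [oneForm_basis]
    exact (hs i).comp (contDiff_id.prodMk contDiff_const)
  · have := eq_zero_section_of_pdw_eq_zero (hs i) (fun j q => by
      rw [pdw_sub _ ((hl'.1.pdw i).differentiableAt_top q) ((hl.1.pdw i).differentiableAt_top q)]
      have h1 := congrFun (congrFun (hl.2 q) j) i
      have h2 := congrFun (congrFun (hl'.2 q) j) i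
      rw [hessian, of_apply] at h1 h2
      rw [h1, h2, sub_self]) p.1 p.2
    simp only [Prod.mk.eta] at this
    rw [oneForm_basis, ← this]
    ring

theorem SmoothOneCurve.contDiff_linear (hα : SmoothOneCurve α) :
    ContDiff ℝ ∞ fun p : ℝ × (Fin n → ℝ) => ∑ i, (α p.1 (b i)).val * p.2 i :=
  ContDiff.sum fun i _ => ((hα (b i)).comp contDiff_fst).mul (by fun_prop)

theorem SmoothOneCurve.differentiableAt_fst (hα : SmoothOneCurve α) (x : 𝔤)
    (p : ℝ × (Fin n → ℝ)) :
    DifferentiableAt ℝ (fun q : ℝ × (Fin n → ℝ) => (α q.1 x).val) p :=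
  ((hα x).comp contDiff_fst).differentiable (by simp) p

theorem val_add_coboundary₂ (m : LieZ2 ℝ 𝔤 (TrivR 𝔤)) (f : oneCochain ℝ 𝔤 (TrivR 𝔤)) (x y : 𝔤) :
    ((m + coboundary₂ f).1 x y).val = (m.1 x y).val - (f ⁅x, y⁆).val := by
  have e : (m + coboundary₂ f).1 x y = m.1 x y + (coboundary₂ f).1 x y := rfl
  rw [e, coboundary₂_apply, TrivR.val_add, TrivR.val_neg, sub_eq_add_neg]

theorem pdw_fst_eq_zero {f : ℝ → ℝ} (hf : ContDiff ℝ ∞ f) (j : Fin n) (p : ℝ × (Fin n → ℝ)) :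
    pdw j (fun q => f q.1) p = 0 := by
  have h : HasFDerivAt (fun q : ℝ × (Fin n → ℝ) => f q.1) _ p :=
    (hf.differentiable (by simp) p.1).hasDerivAt.hasFDerivAt.comp p hasFDerivAt_fst
  rw [pdw, h.fderiv]
  simp

theorem isShift_add_linear (hl : ContDiff ℝ ∞ l) (hα : SmoothOneCurve α) :
    IsShift b l (fun p => l p + ∑ i, (α p.1 (b i)).val * p.2 i) α where
  smooth := hα
  pdw_eq i p := by
    have hd : ∀ j : Fin n, DifferentiableAt ℝ
        (fun q : ℝ × (Fin n → ℝ) => (α q.1 (b j)).val) p := fun j =>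
      hα.differentiableAt_fst (b j) p
    rw [pdw_add _ (hl.differentiableAt_top p)
      ((hα.contDiff_linear).differentiableAt_top p),
      pdw_sum _ fun j _ => (hd j).fun_mul (differentiableAt_snd_apply j p)]
    congr 1
    rw [Finset.sum_eq_single i]
    · rw [pdw_mul _ (hd i) (differentiableAt_snd_apply i p), pdw_fst_eq_zero (hα (b i)), pdw_snd]
      simp
    · intro j _ hj
      rw [pdw_mul _ (hd j) (differentiableAt_snd_apply j p), pdw_fst_eq_zero (hα (b j)), pdw_snd]
      simp [hj]
    · simp

theorem IsShift.isPotential (h : IsShift b l l' α) (hl : IsPotential k l)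
    (hl' : ContDiff ℝ ∞ l') : IsPotential k l' := by
  refine ⟨hl', fun p => ?_⟩
  rw [← hl.2 p]
  ext i j
  simp only [hessian, of_apply]
  rw [show pdw j l' = fun q => pdw j l q + (α q.1 (b j)).val from funext (h.pdw_eq j),
    pdw_add _ ((hl.1.pdw j).differentiableAt_top p)
      (h.smooth.differentiableAt_fst (b j) p),
    pdw_fst_eq_zero (h.smooth (b j)), add_zero]

theorem IsShift.eulerPoincare_eq (h : IsShift b l l' α) (hl : ContDiff ℝ ∞ l) (i : Fin n)
    (p : ℝ × (Fin n → ℝ)) :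
    eulerPoincare (structureConstants b) γ l' i p = eulerPoincare (structureConstants b) γ l i p
      + (h.smooth.velocity p.1 (b i)).val - ∑ j, (α p.1 ⁅b j, b i⁆).val * p.2 j := by
  have e1 : fieldDeriv γ (pdw i l') p = fieldDeriv γ (pdw i l) p
      + (h.smooth.velocity p.1 (b i)).val := by
    rw [show pdw i l' = fun q => pdw i l q + (α q.1 (b i)).val from funext (h.pdw_eq i),
      fieldDeriv_add ((hl.pdw i).differentiableAt_top p)
        (h.smooth.differentiableAt_fst (b i) p)]
    have := (h.smooth.differentiableAt (b i) p.1).hasDerivAt.hasFDerivAt.comp p hasFDerivAt_fst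
    have h2 : HasFDerivAt (fun q : ℝ × (Fin n → ℝ) => (α q.1 (b i)).val) _ p := this
    congr 1
    rw [fieldDeriv, h2.fderiv, SmoothOneCurve.velocity_apply]
    simp
  rw [eulerPoincare, eulerPoincare, e1]
  simp only [h.pdw_eq, val_lie_basis, mul_add, add_mul, Finset.sum_add_distrib, Finset.sum_mul]
  ring

/-- A change of potential by `α` changes `μ` by the coboundary of `α` and `ν` by the velocity
of `α`. -/
theorem IsResidual.shift (h : IsResidual b γ l μ ν) (hl : ContDiff ℝ ∞ l)
    (hα : IsShift b l l' α) :
    IsResidual b γ l' (fun t => μ t + coboundary₂ (α t)) (fun t => ν t + hα.smooth.velocity t) where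
  smooth_two x y := by
    simp only [val_add_coboundary₂]
    exact (h.smooth_two x y).sub (hα.smooth ⁅x, y⁆)
  smooth_one := h.smooth_one.add hα.smooth.smooth_velocity
  eq i t w := by
    rw [hα.eulerPoincare_eq hl, h.eq]
    simp only [val_add_coboundary₂, sub_mul, Finset.sum_sub_distrib, LinearMap.add_apply,
      TrivR.val_add]
    ring

/-- The class of `μ` does not depend on the potential. -/
theorem IsReducedMultiplier.existsUnique_isH2Class (hγ : ∀ i, ContDiff ℝ ∞ (γ i))
    (hk : IsReducedMultiplier (structureConstants b) γ k) :
    ∃! c₂ : ℝ → LieH2 ℝ 𝔤 (TrivR 𝔤), IsH2Class b γ k c₂ := by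
  obtain ⟨l, hl⟩ := exists_isPotential hk.smooth hk.symm hk.deriv_symm
  obtain ⟨μ, ν, h⟩ := hk.exists_isResidual hγ hl
  refine ⟨fun t => Submodule.Quotient.mk (μ t), fun l' hl' => ?_, fun c hc => ?_⟩
  · obtain ⟨α, hα⟩ := hl.exists_isShift b hl'
    exact ⟨_, _, h.shift hl.1 hα, fun t => LieH2_mk_eq_mk_iff.2 ⟨α t, rfl⟩⟩
  · obtain ⟨μ', ν', h', hc'⟩ := hc l hl
    funext t
    rw [← hc' t, (h.unique h').1]

theorem IsH2Class.mk_eq {c : ℝ → LieH2 ℝ 𝔤 (TrivR 𝔤)} (hc : IsH2Class b γ k c)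
    (hl : IsPotential k l) (h : IsResidual b γ l μ ν) (t : ℝ) :
    Submodule.Quotient.mk (μ t) = c t := by
  obtain ⟨μ', ν', h', hc'⟩ := hc l hl
  rw [← hc' t, (h.unique h').1]

/-- The form `ξ = dθ/dt + ν` is a cocycle, since `dθ/dt ([x, y]) = dμ/dt (x, y) = -ν([x, y])`. -/
theorem IsPrimitive.velocity_add_mem (hγ : ∀ i, ContDiff ℝ ∞ (γ i))
    (hk : IsReducedMultiplier (structureConstants b) γ k) (hl : IsPotential k l)
    (h : IsResidual b γ l μ ν) (hθ : IsPrimitive μ θ) (t : ℝ) :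
    hθ.1.velocity t + ν t ∈ LieZ1 ℝ 𝔤 (TrivR 𝔤) := by
  refine mem_LieZ1_of_basis b fun i j => ?_
  rw [LinearMap.add_apply, TrivR.val_add, SmoothOneCurve.velocity_apply]
  simp only [← hθ.2]
  rw [h.deriv_two hγ hk hl]
  ring

theorem IsPrimitive.existsUnique_isH1Class (hγ : ∀ i, ContDiff ℝ ∞ (γ i))
    (hk : IsReducedMultiplier (structureConstants b) γ k) (hl : IsPotential k l)
    (h : IsResidual b γ l μ ν) (hθ : IsPrimitive μ θ) : ∃! c₁, IsH1Class ν θ c₁ := by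
  refine ⟨fun t => Submodule.Quotient.mk ⟨_, hθ.velocity_add_mem hγ hk hl h t⟩,
    ⟨fun t => ⟨_, hθ.velocity_add_mem hγ hk hl h t⟩, fun t x => rfl, fun t => rfl⟩, ?_⟩
  rintro c ⟨ξ, hξ, hc⟩
  funext t
  rw [← hc t]
  refine LieH1_mk_eq_mk_iff.2 (Subtype.ext (LinearMap.ext fun x => TrivR.val_injective ?_))
  exact hξ t x

/-- The curves of classes in `H¹` of two choices of a potential and a primitive differ by the
velocity of the curve of cocycles `θ' - θ + α`. -/
theorem IsH1Class.exists_velocity {c₁ c₁' : ℝ → LieH1 ℝ 𝔤 (TrivR 𝔤)}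
    (hl : IsPotential k l) (h : IsResidual b γ l μ ν) (hθ : IsPrimitive μ θ)
    (hc : IsH1Class ν θ c₁) (hl' : IsPotential k l') (h' : IsResidual b γ l' μ' ν')
    (hθ' : IsPrimitive μ' θ') (hc' : IsH1Class ν' θ' c₁') :
    ∃ η ζ : ℝ → LieZ1 ℝ 𝔤 (TrivR 𝔤), SmoothOneCurve (fun t => (η t).1) ∧
      (∀ t x, HasDerivAt (fun s => ((η s).1 x).val) ((ζ t).1 x).val t) ∧
      ∀ t, c₁' t = c₁ t + Submodule.Quotient.mk (ζ t) := by
  obtain ⟨α, hα⟩ := hl.exists_isShift b hl'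
  obtain ⟨hμ, hν⟩ := h'.unique (h.shift hl.1 hα)
  have hs : SmoothOneCurve fun t => θ' t - θ t + α t := (hθ'.1.sub hθ.1).add hα.smooth
  have hz : ∀ t (x y : 𝔤), (θ' t - θ t + α t) ⁅x, y⁆ = 0 := fun t x y => by
    have e : (μ' t).1 x y = (μ t).1 x y - α t ⁅x, y⁆ := by
      rw [hμ]
      have := coboundary₂_apply (α t) x y
      rw [sub_eq_add_neg, ← this]
      rfl
    rw [hθ.2, hθ'.2] at e
    rw [LinearMap.add_apply, LinearMap.sub_apply, e]
    abel
  have hvz : ∀ t (x y : 𝔤), hs.velocity t ⁅x, y⁆ = 0 := fun t x y => by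
    refine TrivR.val_injective ?_
    rw [SmoothOneCurve.velocity_apply]
    simp only [hz, TrivR.val_zero, deriv_const]
  obtain ⟨ξ, hξ, hc⟩ := hc
  obtain ⟨ξ', hξ', hc'⟩ := hc'
  refine ⟨fun t => ⟨_, mem_LieZ1_iff.2 (hz t)⟩, fun t => ⟨_, mem_LieZ1_iff.2 (hvz t)⟩, hs,
    fun t x => (hs.differentiableAt x t).hasDerivAt, fun t => ?_⟩
  rw [← hc t, ← hc' t, ← Submodule.Quotient.mk_add]
  refine LieH1_mk_eq_mk_iff.2 (Subtype.ext (LinearMap.ext fun x => TrivR.val_injective ?_))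
  have e1 : deriv (fun s => ((θ' s - θ s + α s) x).val) t
      = deriv (fun s => (θ' s x).val) t - deriv (fun s => (θ s x).val) t
        + deriv (fun s => (α s x).val) t :=
    (((hθ'.1.differentiableAt x t).hasDerivAt.sub (hθ.1.differentiableAt x t).hasDerivAt).add
      (hα.smooth.differentiableAt x t).hasDerivAt).deriv
  have e2 : (((ξ t + ⟨hs.velocity t, mem_LieZ1_iff.2 (hvz t)⟩ : LieZ1 ℝ 𝔤 (TrivR 𝔤)).1) x).val
      = ((ξ t).1 x).val + deriv (fun s => ((θ' s - θ s + α s) x).val) t := rfl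
  have e3 : (ν' t x).val = (ν t x).val + deriv (fun s => (α s x).val) t := by
    rw [hν]
    rfl
  rw [e2, e1, hξ, hξ', e3]
  ring

/-- If both classes vanish, the potential can be chosen with vanishing Euler–Poincaré
expressions. -/
theorem exists_eulerPoincare_eq_zero (hl : IsPotential k l) (h : IsResidual b γ l μ ν)
    (hθ : IsPrimitive μ θ) (hc : IsH1Class ν θ fun _ => 0) :
    ∃ l', IsPotential k l' ∧ ∀ i p, eulerPoincare (structureConstants b) γ l' i p = 0 := by
  have hsh := isShift_add_linear (b := b) hl.1 hθ.1
  refine ⟨_, hsh.isPotential hl (hl.1.add (hθ.1.contDiff_linear)), fun i p => ?_⟩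
  obtain ⟨ξ, hξ, hc⟩ := hc
  have hξ0 : ∀ t, ξ t = 0 := fun t =>
    LieH1_mk_eq_mk_iff.1 ((hc t).trans (Submodule.Quotient.mk_zero _).symm)
  have e := hξ p.1 (b i)
  rw [hξ0, ← hθ.1.velocity_apply] at e
  have e' : (hθ.1.velocity p.1 (b i)).val + (ν p.1 (b i)).val = 0 := e.symm
  rw [hsh.eulerPoincare_eq hl.1, h.eq i p.1 p.2]
  simp only [hθ.2]
  linarith

/-- A function with nondegenerate Hessian and vanishing Euler–Poincaré expressions gives a reduced
multiplier. -/
theorem isReducedMultiplier_of_eulerPoincare_eq_zero {C : Fin n → Fin n → Fin n → ℝ}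
    (hC : IsLieConstants C) (hγ : ∀ i, ContDiff ℝ ∞ (γ i))
    (hl : ContDiff ℝ ∞ l) (hdet : ∀ p, (hessian l p).det ≠ 0)
    (hV : ∀ i p, eulerPoincare C γ l i p = 0) :
    IsReducedMultiplier C γ (hessian l) := by
  have hE : ∀ p, epMat C γ l p = 0 := fun p => by
    ext i j
    rw [epMat, of_apply, show eulerPoincare C γ l i = fun _ => 0 from funext (hV i)]
    simp [pdw]
  have hK := (epMat_transpose_iff hC hγ hl).1 fun p => by simp [hE]
  have hsymm : ∀ p i j, hessian l p i j = hessian l p j i := fun p i j => pdw_comm hl i j p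
  refine ⟨fun i j => contDiff_hessian hl i j, hdet, hsymm, multiplierTransport_iff.1 hK, ?_, ?_⟩
  · intro p i j
    have h := matDeriv_epMat hC hγ hl hK p
    rw [show epMat C γ l = fun _ => 0 from funext hE] at h
    have h0 : matDeriv γ (fun _ => (0 : Matrix (Fin n) (Fin n) ℝ)) p = 0 := by
      ext i j
      simp [matDeriv, fieldDeriv]
    have h1 : coboundaryMat C (fun k => eulerPoincare C γ l k p) = 0 := by
      ext i j
      simp [coboundaryMat, hV]
    rw [h0, h1] at h
    simp only [zero_mul, mul_zero, add_zero, sub_zero] at h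
    have h2 := congrFun (congrFun (sub_eq_zero.1 h.symm) i) j
    simp only [transpose_apply, Matrix.mul_apply, phiMat, of_apply] at h2
    simp only [hsymm p _ i, hsymm p _ j]
    exact h2
  · intro p i j m
    rw [hessian_apply_comm hl, hessian_apply_comm hl, pdw_comm (hl.pdw j),
      show pdw i (pdw j l) = pdw j (pdw i l) from funext (pdw_comm hl i j),
      pdw_comm (hl.pdw i) m j]

/-- For a potential with vanishing Euler–Poincaré expressions the residual of every other potential
is exact. -/
theorem exists_primitive_of_eulerPoincare_eq_zero
    (hl : IsPotential k l) (hV : ∀ i p, eulerPoincare (structureConstants b) γ l i p = 0) :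
    IsH2Class b γ k (fun _ => 0) ∧
      ∀ l' μ ν, IsPotential k l' → IsResidual b γ l' μ ν →
        ∃ θ, IsPrimitive μ θ ∧ IsH1Class ν θ (fun _ => 0) := by
  have h0 : IsResidual b γ l (fun _ => 0) (fun _ => 0) :=
    ⟨fun _ _ => contDiff_const, fun _ => contDiff_const, fun i t w => by
      have e : ∀ x y : 𝔤, ((0 : LieZ2 ℝ 𝔤 (TrivR 𝔤)).1 x y).val = 0 := fun _ _ => rfl
      rw [hV]
      simp only [e, zero_mul, Finset.sum_const_zero, zero_add]
      rfl⟩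
  refine ⟨fun l' hl' => ?_, fun l' μ ν hl' h' => ?_⟩
  · obtain ⟨α, hα⟩ := hl.exists_isShift b hl'
    exact ⟨_, _, h0.shift hl.1 hα, fun t =>
      (LieH2_mk_eq_mk_iff.2 ⟨α t, rfl⟩).trans (Submodule.Quotient.mk_zero _)⟩
  · obtain ⟨α, hα⟩ := hl.exists_isShift b hl'
    obtain ⟨rfl, rfl⟩ := h'.unique (h0.shift hl.1 hα)
    refine ⟨fun t => -α t, ⟨hα.smooth.neg, fun t x y => ?_⟩, fun _ => 0, fun t x => ?_, fun t =>
      Submodule.Quotient.mk_zero _⟩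
    · have e : (0 + coboundary₂ (α t)).1 x y = (coboundary₂ (α t)).1 x y := by rw [zero_add]
      exact e.trans (coboundary₂_apply _ _ _)
    · have e : deriv (fun s => ((-α s) x).val) t = -deriv (fun s => (α s x).val) t :=
        deriv.neg
      have e' : (((0 : oneCochain ℝ 𝔤 (TrivR 𝔤)) + hα.smooth.velocity t) x).val
          = deriv (fun s => (α s x).val) t := by rw [zero_add, SmoothOneCurve.velocity_apply]
      rw [e]
      exact (neg_add_eq_zero.2 e'.symm).symm

end Shift

/-! ### Euler–Lagrange equations in a moving frame -/

section MovingFrame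

open Filter Topology

variable {n : ℕ} {E : Type*} [NormedAddCommGroup E] [NormedSpace ℝ E]
  {C : Fin n → Fin n → Fin n → ℝ} {W : E → E →L[ℝ] (Fin n → ℝ)} {l : ℝ × (Fin n → ℝ) → ℝ}

/-- The Maurer–Cartan equation `dW (u, v) = -[W u, W v]` at `x` for a coframe `W` on a vector
space, the bracket on `ℝⁿ` having structure constants `C`. -/
def MaurerCartanAt (C : Fin n → Fin n → Fin n → ℝ) (W : E → E →L[ℝ] (Fin n → ℝ)) (x : E) : Prop :=
  ∀ u v k, fderiv ℝ W x u v k - fderiv ℝ W x v u k = ∑ i, ∑ j, W x u i * W x v j * C j i k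

/-- The Maurer–Cartan equation follows from the brackets of the dual frame. -/
theorem maurerCartanAt_of_lieBracket {x : E} {X : Fin n → E → E} (hW : DifferentiableAt ℝ W x)
    (hinj : Function.Injective (W x)) (hX : ∀ i, DifferentiableAt ℝ (X i) x)
    (hWX : ∀ i, ∀ᶠ y in 𝓝 x, W y (X i y) = Pi.single i 1)
    (hbr : ∀ i j k, W x (VectorField.lieBracket ℝ (X i) (X j) x) k = C i j k)
    (hC : ∀ i j k, C i j k = -C j i k) : MaurerCartanAt C W x := by
  have hd : ∀ j u, fderiv ℝ W x u (X j x) + W x (fderiv ℝ (X j) x u) = 0 := fun j u => by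
    have h1 := hW.hasFDerivAt.clm_apply (hX j).hasFDerivAt
    have h2 : HasFDerivAt (fun y => W y (X j y)) (0 : E →L[ℝ] (Fin n → ℝ)) x :=
      (hasFDerivAt_const _ x).congr_of_eventuallyEq (hWX j)
    have h3 := congrArg (fun T : E →L[ℝ] (Fin n → ℝ) => T u) (h1.unique h2)
    simpa [add_comm] using h3
  have hx : ∀ u, u = ∑ i, W x u i • X i x := fun u => by
    apply hinj
    rw [map_sum]
    ext k
    simp [(hWX _).self_of_nhds, Finset.sum_apply, Pi.single_apply]
  have hb : ∀ i j k, fderiv ℝ W x (X i x) (X j x) k - fderiv ℝ W x (X j x) (X i x) k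
      = C j i k := fun i j k => by
    rw [hC, ← hbr i j k, VectorField.lieBracket, map_sub, eq_neg_of_add_eq_zero_left (hd j (X i x)),
      eq_neg_of_add_eq_zero_left (hd i (X j x))]
    simp only [Pi.sub_apply, Pi.neg_apply]
    ring
  have hexp : ∀ u v k, fderiv ℝ W x u v k
      = ∑ i, ∑ j, W x u i * W x v j * fderiv ℝ W x (X i x) (X j x) k := fun u v k => by
    conv_lhs => rw [hx u, hx v]
    simp only [map_sum, map_smul, sum_apply, smul_apply, Finset.sum_apply, Pi.smul_apply,
      smul_eq_mul, Finset.mul_sum]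
    rw [Finset.sum_comm]
    exact Finset.sum_congr rfl fun i _ => Finset.sum_congr rfl fun j _ => by ring
  intro u v k
  rw [hexp u v, hexp v u, Finset.sum_comm (s := Finset.univ) (t := Finset.univ)
    (f := fun i j => W x v i * W x u j * fderiv ℝ W x (X i x) (X j x) k),
    ← Finset.sum_sub_distrib]
  refine Finset.sum_congr rfl fun i _ => ?_
  rw [← Finset.sum_sub_distrib]
  refine Finset.sum_congr rfl fun j _ => ?_
  rw [← hb i j k]
  ring

theorem hasFDerivAt_fibre {Λ : E →L[ℝ] (Fin n → ℝ)} (hl : ContDiff ℝ ∞ l) (t : ℝ) (v : E) :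
    HasFDerivAt (fun v => l (t, Λ v))
      (∑ i, pdw i l (t, Λ v) • (ContinuousLinearMap.proj i).comp Λ) v := by
  have h := (hl.differentiableAt_top (t, Λ v)).hasFDerivAt.comp v
    ((hasFDerivAt_prodMk_right t (Λ v)).comp v Λ.hasFDerivAt)
  refine h.congr_fderiv ?_
  ext u
  simp [fderiv_vertical, mul_comm]

/-- Along a curve `q` with `w = W q̇`, the Euler–Lagrange equations of the Lagrangian
`(t, x, v) ↦ l(t, W(x) v)` are the Euler–Poincaré equations
`d/dt (∂l/∂wⁱ) = Cⱼᵢᵏ (∂l/∂wᵏ) wʲ`, by the Maurer–Cartan equation of the coframe `W`. -/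
theorem eulerLagrange_iff_eulerPoincare (hl : ContDiff ℝ ∞ l) {q : ℝ → E} {t₀ : ℝ}
    {w' : Fin n → ℝ} (hW : DifferentiableAt ℝ W (q t₀)) (hsurj : Function.Surjective (W (q t₀)))
    (hMC : MaurerCartanAt C W (q t₀)) (hq : DifferentiableAt ℝ q t₀)
    (hw : HasDerivAt (fun t => W (q t) (deriv q t)) w' t₀) :
    HasDerivAt (fun t => fderiv ℝ (fun v => l (t, W (q t) v)) (deriv q t))
        (fderiv ℝ (fun x => l (t₀, W x (deriv q t₀))) (q t₀)) t₀ ↔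
      ∀ i, fderiv ℝ (pdw i l) (t₀, W (q t₀) (deriv q t₀)) (1, w')
        = ∑ j, ∑ k, C j i k * pdw k l (t₀, W (q t₀) (deriv q t₀)) * W (q t₀) (deriv q t₀) j := by
  let π : ∀ i, (Fin n → ℝ) →L[ℝ] ℝ := ContinuousLinearMap.proj
  have hπ : ∀ i y, π i y = y i := fun _ _ => rfl
  set v := deriv q t₀
  set x := q t₀
  have hq' : HasDerivAt q v t₀ := hq.hasDerivAt
  -- the derivative of the momentum along the curve
  have hp : ∀ i, HasDerivAt (fun t => pdw i l (t, W (q t) (deriv q t)))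
      (fderiv ℝ (pdw i l) (t₀, W x v) (1, w')) t₀ := fun i =>
    HasFDerivAt.comp_hasDerivAt (f := fun t => (t, W (q t) (deriv q t))) t₀
      ((hl.pdw i).differentiableAt_top (t₀, W x v)).hasFDerivAt ((hasDerivAt_id' t₀).prodMk hw)
  have hWq : HasDerivAt (fun t => W (q t)) (fderiv ℝ W x v) t₀ :=
    hW.hasFDerivAt.comp_hasDerivAt t₀ hq'
  have hL : HasDerivAt (fun t => fderiv ℝ (fun v => l (t, W (q t) v)) (deriv q t))
      (∑ i, (pdw i l (t₀, W x v) • (π i).comp (fderiv ℝ W x v)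
        + fderiv ℝ (pdw i l) (t₀, W x v) (1, w') • (π i).comp (W x))) t₀ := by
    simp only [fun t => (hasFDerivAt_fibre (Λ := W (q t)) hl t (deriv q t)).fderiv]
    refine HasDerivAt.fun_sum fun i _ => ?_
    have h1 : HasDerivAt (fun t => (π i).comp (W (q t))) ((π i).comp (fderiv ℝ W x v)) t₀ :=
      (ContinuousLinearMap.compL ℝ E (Fin n → ℝ) ℝ (π i)).hasFDerivAt.comp_hasDerivAt t₀ hWq
    exact (hp i).smul h1
  have hR : HasFDerivAt (fun y => l (t₀, W y v))
      (∑ i, pdw i l (t₀, W x v) • (π i).comp ((fderiv ℝ W x).flip v)) x := by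
    have h1 : HasFDerivAt (fun y => W y v) ((fderiv ℝ W x).flip v) x := by
      have := hW.hasFDerivAt.clm_apply (hasFDerivAt_const v x)
      refine this.congr_fderiv ?_
      ext u
      simp
    have h := (hl.differentiableAt_top (t₀, W x v)).hasFDerivAt.comp x
      ((hasFDerivAt_prodMk_right t₀ (W x v)).comp x h1)
    refine h.congr_fderiv ?_
    ext u
    simp [fderiv_vertical, hπ, mul_comm]
  rw [hR.fderiv]
  have huniq : ∀ D, HasDerivAt (fun t => fderiv ℝ (fun v => l (t, W (q t) v)) (deriv q t)) D t₀ ↔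
      _ = D := fun D => ⟨fun h => hL.unique h, fun h => h ▸ hL⟩
  rw [huniq, ContinuousLinearMap.ext_iff]
  -- evaluated on `u`, the equation between covectors is the combination of the Euler–Poincaré
  -- equations with coefficients `W u`
  have key : ∀ u, ((∑ i, (pdw i l (t₀, W x v) • (π i).comp (fderiv ℝ W x v)
        + fderiv ℝ (pdw i l) (t₀, W x v) (1, w') • (π i).comp (W x))) u
      = (∑ i, pdw i l (t₀, W x v) • (π i).comp ((fderiv ℝ W x).flip v)) u) ↔
      ∑ i, W x u i * fderiv ℝ (pdw i l) (t₀, W x v) (1, w')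
        = ∑ i, W x u i * ∑ j, ∑ k, C j i k * pdw k l (t₀, W x v) * W x v j := fun u => by
    have e : ∑ i, W x u i * ∑ j, ∑ k, C j i k * pdw k l (t₀, W x v) * W x v j
        = ∑ k, pdw k l (t₀, W x v) * (fderiv ℝ W x u v k - fderiv ℝ W x v u k) := by
      simp only [hMC u v, Finset.mul_sum]
      rw [Finset.sum_comm_cycle]
      refine Finset.sum_congr rfl fun k _ => Finset.sum_congr rfl fun i _ =>
        Finset.sum_congr rfl fun j _ => ?_
      ring
    rw [e]
    simp only [sum_apply, add_apply, smul_apply, ContinuousLinearMap.comp_apply,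
      ContinuousLinearMap.flip_apply, hπ, smul_eq_mul,
      Finset.sum_add_distrib, mul_sub, Finset.sum_sub_distrib, mul_comm (W x u _)]
    constructor <;> intro h <;> linarith
  simp only [key]
  constructor
  · intro h i
    obtain ⟨u, hu⟩ := hsurj (Pi.single i 1)
    simpa [hu, Pi.single_apply] using h u
  · intro h u
    simp only [h]

end MovingFrame

/-! ### The Maurer–Cartan form of a Lie group -/

section MaurerCartan

open Bundle Filter Topology

/-- Over the base point of a trivialization of the tangent bundle, the trivialization is the
identity on the fibre. -/
theorem trivializationAt_snd_of_proj_eq {n : ℕ} {G : Type*} [TopologicalSpace G]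
    [ChartedSpace (EuclideanSpace ℝ (Fin n)) G] [IsManifold (𝓡 n) ∞ G] {x : G}
    (z : TangentBundle (𝓡 n) G) (h : z.proj = x) :
    (trivializationAt (EuclideanSpace ℝ (Fin n)) (TangentSpace (𝓡 n)) x z).2 = z.2 := by
  subst h
  exact (tangentBundleCore (𝓡 n) G).coordChange_self (achart _ z.proj) z.proj
    (mem_chart_source _ _) z.2

variable {n : ℕ} {G : Type*} [TopologicalSpace G] [ChartedSpace (EuclideanSpace ℝ (Fin n)) G]
  [Group G] (b : Module.Basis (Fin n) ℝ (GroupLieAlgebra (𝓡 n) G))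

/-- The coordinates of tangent vectors at the identity with respect to the basis `b`. -/
def coordEquiv : EuclideanSpace ℝ (Fin n) ≃L[ℝ] (Fin n → ℝ) :=
  LinearEquiv.toContinuousLinearEquiv (E := EuclideanSpace ℝ (Fin n)) b.equivFun

/-- The Maurer–Cartan form `v ↦ g⁻¹ v` at `g`, in the coordinates given by the basis `b`. -/
def mcForm (g : G) : EuclideanSpace ℝ (Fin n) →L[ℝ] (Fin n → ℝ) :=
  (coordEquiv b : EuclideanSpace ℝ (Fin n) →L[ℝ] (Fin n → ℝ)).comp
    (show EuclideanSpace ℝ (Fin n) →L[ℝ] EuclideanSpace ℝ (Fin n) from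
      mfderiv (𝓡 n) (𝓡 n) (fun h => g⁻¹ * h) g)

theorem reducedVelocity_eq (c : ℝ → G) (t : ℝ) :
    reducedVelocity b c t = mcForm b (c t)
      (show EuclideanSpace ℝ (Fin n) from mfderiv 𝓘(ℝ, ℝ) (𝓡 n) c t (1 : ℝ)) := rfl

theorem mcForm_one : mcForm b (1 : G) = coordEquiv b := by
  ext v
  have : (fun h : G => (1 : G)⁻¹ * h) = id := by ext; simp
  have h2 := mfderiv_id (I := 𝓡 n) (x := (1 : G))
  rw [← this] at h2
  rw [mcForm, h2]
  rfl

variable [LieGroup (𝓡 n) ∞ G]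

theorem mdifferentiableAt_mul_left_top (g h : G) :
    MDifferentiableAt (𝓡 n) (𝓡 n) (fun x => g * x) h :=
  (contMDiff_mul_left (I := 𝓡 n) (n := ∞)).contMDiffAt.mdifferentiableAt (by simp)

/-- The Maurer–Cartan form is left-invariant. -/
theorem mcForm_mul (g h : G) (v : EuclideanSpace ℝ (Fin n)) :
    mcForm b (g * h) (show EuclideanSpace ℝ (Fin n) from
      mfderiv (𝓡 n) (𝓡 n) (fun x => g * x) h v) = mcForm b h v := by
  have e : (fun x => (g * h)⁻¹ * x) ∘ (fun x => g * x) = fun x : G => h⁻¹ * x := by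
    ext x
    simp [mul_assoc]
  have h1 := mfderiv_comp (I' := 𝓡 n) h (mdifferentiableAt_mul_left_top (G := G) (g * h)⁻¹ (g * h))
    (mdifferentiableAt_mul_left_top (G := G) g h)
  rw [e] at h1
  rw [mcForm, mcForm, h1]
  rfl

theorem mcForm_mulInvariantVectorField (v : GroupLieAlgebra (𝓡 n) G) (g : G) :
    mcForm b g (show EuclideanSpace ℝ (Fin n) from mulInvariantVectorField v g) = b.repr v := by
  have := mcForm_mul b g 1 v
  rw [mul_one, mcForm_one] at this
  exact this

theorem mcForm_bijective (g : G) : Function.Bijective (mcForm b g) := by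
  have hsurj : Function.Surjective (mcForm b g) := fun w =>
    ⟨mulInvariantVectorField (b.equivFun.symm w) g, by
      rw [mcForm_mulInvariantVectorField]
      exact b.equivFun.apply_symm_apply w⟩
  have hd : Module.finrank ℝ (EuclideanSpace ℝ (Fin n)) = Module.finrank ℝ (Fin n → ℝ) := by simp
  exact ⟨(LinearMap.injective_iff_surjective_of_finrank_eq_finrank hd
    (f := (mcForm b g : EuclideanSpace ℝ (Fin n) →ₗ[ℝ] (Fin n → ℝ)))).2 hsurj, hsurj⟩

/-- The Maurer–Cartan form is smooth on the tangent bundle: it is the tangent map of the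
multiplication, applied to the zero vector at `g⁻¹` and a vector at `g`. -/
theorem contMDiff_mcForm :
    ContMDiff (𝓡 n).tangent 𝓘(ℝ, Fin n → ℝ) ∞
      (fun v : TangentBundle (𝓡 n) G => mcForm b v.1 v.2) := by
  let F₁ : TangentBundle (𝓡 n) G → TangentBundle (𝓡 n) G × TangentBundle (𝓡 n) G :=
    fun v => (⟨v.1⁻¹, 0⟩, v)
  have S₁ : ContMDiff (𝓡 n).tangent ((𝓡 n).tangent.prod (𝓡 n).tangent) ∞ F₁ := by
    refine ContMDiff.prodMk ?_ contMDiff_id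
    have h1 : ContMDiff (𝓡 n).tangent (𝓡 n) ∞ (fun v : TangentBundle (𝓡 n) G => v.1⁻¹) :=
      (contMDiff_inv (𝓡 n) ∞).comp (contMDiff_proj (TangentSpace (𝓡 n)))
    exact (contMDiff_zeroSection ℝ (TangentSpace (𝓡 n) : G → Type _)).comp h1
  have S₂ : ContMDiff ((𝓡 n).tangent.prod (𝓡 n).tangent) ((𝓡 n).prod (𝓡 n)).tangent ∞
    (equivTangentBundleProd (𝓡 n) G (𝓡 n) G).symm := contMDiff_equivTangentBundleProd_symm
  have S₃ : ContMDiff ((𝓡 n).prod (𝓡 n)).tangent (𝓡 n).tangent ∞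
      (tangentMap ((𝓡 n).prod (𝓡 n)) (𝓡 n) (fun p : G × G => p.1 * p.2)) :=
    (contMDiff_mul (𝓡 n) ∞).contMDiff_tangentMap (m := ∞) (by simp)
  have S := (S₃.comp S₂).comp S₁
  -- the composition maps `v` at `g` to the vector `g⁻¹ v` at `g⁻¹ g`
  have hF : ∀ v, (tangentMap ((𝓡 n).prod (𝓡 n)) (𝓡 n) (fun p : G × G => p.1 * p.2) ∘
      (equivTangentBundleProd (𝓡 n) G (𝓡 n) G).symm) (F₁ v)
        = ⟨v.1⁻¹ * v.1, mfderiv (𝓡 n) (𝓡 n) (fun h => v.1⁻¹ * h) v.1 v.2⟩ := fun v => by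
    simp only [Function.comp_apply, tangentMap, F₁]
    rw [mfderiv_prod_eq_add_apply ((contMDiff_mul (𝓡 n) ∞).mdifferentiableAt (by simp))]
    simp +instances
    refine heq_of_eq ?_
    exact (congrArg₂ (· + ·) (map_zero _) rfl).trans (zero_add _)
  let F : TangentBundle (𝓡 n) G → TangentBundle (𝓡 n) G :=
    fun v => ⟨v.1⁻¹ * v.1, mfderiv (𝓡 n) (𝓡 n) (fun h => v.1⁻¹ * h) v.1 v.2⟩
  have S' : ContMDiff (𝓡 n).tangent (𝓡 n).tangent ∞ F := by
    rw [show F = _ from (funext hF).symm]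
    exact S
  intro v₀
  have h2 := (coordEquiv b).contDiff.contMDiff.contMDiffAt.comp v₀
    (contMDiffAt_totalSpace.1 (S' v₀)).2
  refine h2.congr_of_eventuallyEq (Eventually.of_forall fun v => ?_)
  have h3 := trivializationAt_snd_of_proj_eq (x := (F v₀).proj) (F v)
    ((inv_mul_cancel v.1).trans (inv_mul_cancel v₀.1).symm)
  exact (congrArg (coordEquiv b) h3).symm

end MaurerCartan

/-! ### The Maurer–Cartan form in a chart -/

section Chart

open Bundle Filter Topology

/-- The bracket of vector fields at `g₀`, in the chart at `g₀`. The chart at `g₀` identifies the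
tangent space at `g₀` with the model space, so no derivative of the chart appears. -/
theorem mlieBracket_eq_lieBracket_chart {n : ℕ} {G : Type*} [TopologicalSpace G]
    [ChartedSpace (EuclideanSpace ℝ (Fin n)) G] [IsManifold (𝓡 n) 1 G] (g₀ : G)
    (V V' : Π g : G, TangentSpace (𝓡 n) g) :
    VectorField.mlieBracket (𝓡 n) V V' g₀ = (VectorField.lieBracket ℝ
      (VectorField.mpullbackWithin 𝓘(ℝ, EuclideanSpace ℝ (Fin n)) (𝓡 n) (extChartAt (𝓡 n) g₀).symm
        V (Set.range (𝓡 n)))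
      (VectorField.mpullbackWithin 𝓘(ℝ, EuclideanSpace ℝ (Fin n)) (𝓡 n) (extChartAt (𝓡 n) g₀).symm
        V' (Set.range (𝓡 n))) (extChartAt (𝓡 n) g₀ g₀) :) := by
  have e : (mfderiv (𝓡 n) 𝓘(ℝ, EuclideanSpace ℝ (Fin n)) (extChartAt (𝓡 n) g₀) g₀).inverse
      = ContinuousLinearMap.id ℝ _ := by
    rw [mfderiv_extChartAt_self]
    exact ContinuousLinearMap.inverse_id
  rw [← VectorField.mlieBracketWithin_univ, VectorField.mlieBracketWithin_apply, e,
    Set.preimage_univ, Set.univ_inter, ModelWithCorners.range_eq_univ]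
  exact congrFun (VectorField.lieBracketWithin_univ (𝕜 := ℝ) (E := EuclideanSpace ℝ (Fin n))) _

variable {n : ℕ} {G : Type*} [TopologicalSpace G] [ChartedSpace (EuclideanSpace ℝ (Fin n)) G]
  [Group G] (b : Module.Basis (Fin n) ℝ (GroupLieAlgebra (𝓡 n) G))

/-- The Maurer–Cartan form in the chart at `g₀`: a coframe on the target of the chart. -/
def chartForm (g₀ : G) (x : EuclideanSpace ℝ (Fin n)) :
    EuclideanSpace ℝ (Fin n) →L[ℝ] (Fin n → ℝ) :=
  (mcForm b ((extChartAt (𝓡 n) g₀).symm x)).comp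
    (show EuclideanSpace ℝ (Fin n) →L[ℝ] EuclideanSpace ℝ (Fin n) from
      mfderiv 𝓘(ℝ, EuclideanSpace ℝ (Fin n)) (𝓡 n) (extChartAt (𝓡 n) g₀).symm x)

variable [LieGroup (𝓡 n) ∞ G]

theorem contDiffOn_chartForm (g₀ : G) :
    ContDiffOn ℝ ∞ (chartForm b g₀) (extChartAt (𝓡 n) g₀).target := by
  rw [contDiffOn_clm_apply]
  intro v
  rw [← contMDiffOn_iff_contDiffOn]
  have h1 : ContMDiffOn 𝓘(ℝ, EuclideanSpace ℝ (Fin n)) (𝓡 n) ∞ (extChartAt (𝓡 n) g₀).symm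
    (extChartAt (𝓡 n) g₀).target := contMDiffOn_extChartAt_symm g₀
  have h2 := h1.contMDiffOn_tangentMapWithin (m := ∞) (by simp)
    (isOpen_extChartAt_target (I := 𝓡 n) g₀).uniqueMDiffOn
  have h3 : ContMDiff 𝓘(ℝ, EuclideanSpace ℝ (Fin n)) 𝓘(ℝ, EuclideanSpace ℝ (Fin n)).tangent ∞
      (fun x : EuclideanSpace ℝ (Fin n) =>
        (⟨x, v⟩ : TangentBundle 𝓘(ℝ, EuclideanSpace ℝ (Fin n)) (EuclideanSpace ℝ (Fin n)))) := by
    intro x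
    refine (contMDiffAt_section (IB := 𝓘(ℝ, EuclideanSpace ℝ (Fin n)))
      (E := TangentSpace 𝓘(ℝ, EuclideanSpace ℝ (Fin n))) (s := fun _ => v) x).2 ?_
    simp only [trivializationAt_model_space_apply]
    exact contMDiffAt_const
  have h4 := (contMDiff_mcForm b).comp_contMDiffOn
    (h2.comp (h3.contMDiffOn (s := (extChartAt (𝓡 n) g₀).target)) fun x hx => hx)
  refine h4.congr fun x hx => ?_
  simp only [Function.comp_apply, tangentMapWithin]
  rw [mfderivWithin_eq_mfderiv ((isOpen_extChartAt_target (I := 𝓡 n) g₀).uniqueMDiffWithinAt hx)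
    ((h1.mdifferentiableOn (by simp)).mdifferentiableAt
      (extChartAt_target_mem_nhds' (I := 𝓡 n) hx))]
  rfl

theorem chartForm_bijective {g₀ : G} {x : EuclideanSpace ℝ (Fin n)}
    (hx : x ∈ (extChartAt (𝓡 n) g₀).target) : Function.Bijective (chartForm b g₀ x) := by
  have h := isInvertible_mfderivWithin_extChartAt_symm (I := 𝓡 n) hx
  rw [ModelWithCorners.range_eq_univ, mfderivWithin_univ] at h
  exact (mcForm_bijective b _).comp h.bijective

theorem chartForm_isInvertible {g₀ : G} {x : EuclideanSpace ℝ (Fin n)}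
    (hx : x ∈ (extChartAt (𝓡 n) g₀).target) : (chartForm b g₀ x).IsInvertible :=
  ⟨(LinearEquiv.ofBijective (chartForm b g₀ x : EuclideanSpace ℝ (Fin n) →ₗ[ℝ] (Fin n → ℝ))
    (chartForm_bijective b hx)).toContinuousLinearEquiv, by ext; rfl⟩

theorem chartForm_self (g₀ : G) :
    chartForm b g₀ (extChartAt (𝓡 n) g₀ g₀) = mcForm b g₀ := by
  have h := mfderivWithin_range_extChartAt_symm (I := 𝓡 n) (x := g₀)
  rw [ModelWithCorners.range_eq_univ, mfderivWithin_univ] at h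
  rw [chartForm, h, extChartAt_to_inv]
  rfl

/-- The Maurer–Cartan equation of the Maurer–Cartan form, in a chart. -/
theorem maurerCartanAt_chartForm (g₀ : G) :
    MaurerCartanAt (structureConstants b) (chartForm b g₀) (extChartAt (𝓡 n) g₀ g₀) := by
  set x₀ := extChartAt (𝓡 n) g₀ g₀
  have hx₀ : x₀ ∈ (extChartAt (𝓡 n) g₀).target := mem_extChartAt_target g₀
  let Y : Fin n → EuclideanSpace ℝ (Fin n) → EuclideanSpace ℝ (Fin n) := fun i =>
    VectorField.mpullbackWithin 𝓘(ℝ, EuclideanSpace ℝ (Fin n)) (𝓡 n) (extChartAt (𝓡 n) g₀).symm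
      (mulInvariantVectorField (b i)) (Set.range (𝓡 n))
  have hWY : ∀ i, ∀ x ∈ (extChartAt (𝓡 n) g₀).target,
      chartForm b g₀ x (Y i x) = Pi.single i 1 := fun i x hx => by
    have h := isInvertible_mfderivWithin_extChartAt_symm (I := 𝓡 n) hx
    have h1 := h.self_apply_inverse (mulInvariantVectorField (b i) ((extChartAt (𝓡 n) g₀).symm x))
    have h2 := mcForm_mulInvariantVectorField b (b i) ((extChartAt (𝓡 n) g₀).symm x)
    rw [ModelWithCorners.range_eq_univ, mfderivWithin_univ] at h1
    have h3 : Y i x = ((mfderiv 𝓘(ℝ, EuclideanSpace ℝ (Fin n)) (𝓡 n)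
        (extChartAt (𝓡 n) g₀).symm x).inverse
          (mulInvariantVectorField (b i) ((extChartAt (𝓡 n) g₀).symm x)) :) := by
      simp only [Y, VectorField.mpullbackWithin_apply, ModelWithCorners.range_eq_univ,
        mfderivWithin_univ]
      rfl
    have h4 : chartForm b g₀ x (Y i x) = b.repr (b i) := by
      rw [h3, ← h2]
      exact congrArg (mcForm b ((extChartAt (𝓡 n) g₀).symm x)) h1
    rw [h4, b.repr_self]
    exact Finsupp.single_eq_pi_single i 1
  have hev : ∀ i, ∀ᶠ x in 𝓝 x₀, chartForm b g₀ x (Y i x) = Pi.single i 1 := fun i =>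
    Filter.mem_of_superset (extChartAt_target_mem_nhds' (I := 𝓡 n) hx₀) fun x hx => hWY i x hx
  have hW := ((contDiffOn_chartForm b g₀).contDiffAt (extChartAt_target_mem_nhds' (I := 𝓡 n) hx₀))
  have hC := isLieConstants_structureConstants b
  refine maurerCartanAt_of_lieBracket (X := Y) (hW.differentiableAt (by simp))
    (chartForm_bijective b hx₀).1 (fun i => ?_) hev (fun i j k => ?_) hC.skew
  · obtain ⟨e, he⟩ := chartForm_isInvertible b hx₀
    have h1 : ContDiffAt ℝ ∞ ContinuousLinearMap.inverse (chartForm b g₀ x₀) := by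
      rw [← he]
      exact contDiffAt_map_inverse e
    have h2 : DifferentiableAt ℝ (fun x => (chartForm b g₀ x).inverse (Pi.single i 1)) x₀ :=
      ((h1.comp x₀ hW).clm_apply contDiffAt_const).differentiableAt (by simp)
    refine h2.congr_of_eventuallyEq ?_
    filter_upwards [extChartAt_target_mem_nhds' (I := 𝓡 n) hx₀] with x hx
    rw [← hWY i x hx, (chartForm_isInvertible b hx).inverse_apply_self]
  · have h1 := congrFun (mulInvariantVector_mlieBracket (b i) (b j)) g₀
    have h3 := h1.trans (mlieBracket_eq_lieBracket_chart g₀ _ _)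
    have h2 := mcForm_mulInvariantVectorField b ⁅b i, b j⁆ g₀
    rw [← chartForm_self] at h2
    rw [structureConstants, ← h2]
    exact congrArg (fun v => chartForm b g₀ x₀ v k) h3.symm

end Chart

/-! ### Invariant Lagrangians and the Euler–Poincaré equations -/

section Reduction

open Bundle Filter Topology

variable {n : ℕ} {G : Type*} [TopologicalSpace G] [ChartedSpace (EuclideanSpace ℝ (Fin n)) G]
  [Group G] (b : Module.Basis (Fin n) ℝ (GroupLieAlgebra (𝓡 n) G))

/-- The left-invariant Lagrangian on `ℝ × TG` with restriction `l` to `ℝ × T₁G`. -/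
def invariantLagrangian (l : ℝ × (Fin n → ℝ) → ℝ) (t : ℝ) (v : TangentBundle (𝓡 n) G) : ℝ :=
  l (t, mcForm b v.1 v.2)

theorem coordEquiv_symm_apply (w : Fin n → ℝ) :
    ((coordEquiv b).symm w : GroupLieAlgebra (𝓡 n) G) = ∑ i, w i • b i :=
  b.equivFun_symm_apply w

theorem reducedLagrangian_eq (L : ℝ → TangentBundle (𝓡 n) G → ℝ) (p : ℝ × (Fin n → ℝ)) :
    reducedLagrangian b L p = L p.1 ⟨1, (coordEquiv b).symm p.2⟩ := by
  rw [reducedLagrangian, ← coordEquiv_symm_apply]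

theorem reducedLagrangian_invariantLagrangian (l : ℝ × (Fin n → ℝ) → ℝ) :
    reducedLagrangian b (invariantLagrangian b l) = l := by
  funext p
  rw [reducedLagrangian_eq, invariantLagrangian, mcForm_one]
  exact congrArg (fun w => l (p.1, w)) ((coordEquiv b).apply_symm_apply p.2)

/-- A left-invariant Lagrangian is determined by its restriction to the Lie algebra. -/
theorem eq_invariantLagrangian {L : ℝ → TangentBundle (𝓡 n) G → ℝ}
    (hL : ∀ (t : ℝ) (g : G) (v : TangentBundle (𝓡 n) G),
      L t (tangentMap (𝓡 n) (𝓡 n) (fun h => g * h) v) = L t v) :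
    L = invariantLagrangian b (reducedLagrangian b L) := by
  funext t v
  rw [← hL t v.1⁻¹ v, invariantLagrangian, reducedLagrangian_eq]
  have h : ∀ (g : G) (_ : g = 1) (w : EuclideanSpace ℝ (Fin n)),
      (⟨g, w⟩ : TangentBundle (𝓡 n) G) = ⟨1, w⟩ := fun g hg w => by subst hg; rfl
  have h2 := h _ (inv_mul_cancel v.1) ((coordEquiv b).symm (mcForm b v.1 v.2))
  rw [← h2]
  exact congrArg (fun w : EuclideanSpace ℝ (Fin n) => L t ⟨v.1⁻¹ * v.1, w⟩)
    ((coordEquiv b).symm_apply_apply _).symm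

/-- The second fibre derivative of an invariant Lagrangian. -/
theorem fderiv_fderiv_invariantLagrangian {l : ℝ × (Fin n → ℝ) → ℝ} (hl : ContDiff ℝ ∞ l) (t : ℝ)
    (g : G) (v u u' : EuclideanSpace ℝ (Fin n)) :
    fderiv ℝ (fderiv ℝ (fun v' : EuclideanSpace ℝ (Fin n) =>
      invariantLagrangian b l t ⟨g, v'⟩)) v u u'
      = Matrix.vecMul (mcForm b g u) (hessian l (t, mcForm b g v)) ⬝ᵥ mcForm b g u' := by
  have h1 : fderiv ℝ (fun v' : EuclideanSpace ℝ (Fin n) => invariantLagrangian b l t ⟨g, v'⟩)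
      = fun v => ∑ i, pdw i l (t, mcForm b g v) •
        (ContinuousLinearMap.proj (R := ℝ) (φ := fun _ : Fin n => ℝ) i).comp (mcForm b g) :=
    funext fun v => (hasFDerivAt_fibre (Λ := mcForm b g) hl t v).fderiv
  have h2 := HasFDerivAt.fun_sum (u := Finset.univ) fun i _ =>
    (hasFDerivAt_fibre (Λ := mcForm b g) (hl.pdw i) t v).smul_const
      ((ContinuousLinearMap.proj (R := ℝ) (φ := fun _ : Fin n => ℝ) i).comp (mcForm b g))
  rw [h1, h2.fderiv]
  simp only [sum_apply, ContinuousLinearMap.smulRight_apply, smul_apply,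
    ContinuousLinearMap.comp_apply, ContinuousLinearMap.proj_apply, smul_eq_mul, dotProduct,
    Matrix.vecMul, hessian, Matrix.of_apply, mul_comm (mcForm b g u _)]

variable [LieGroup (𝓡 n) ∞ G]

theorem IsRegularInvariantLagrangian.contDiff_reducedLagrangian {L : ℝ → TangentBundle (𝓡 n) G → ℝ}
    (hL : IsRegularInvariantLagrangian L) : ContDiff ℝ ∞ (reducedLagrangian b L) := by
  have h1 : ContMDiff 𝓘(ℝ, ℝ × (Fin n → ℝ)) (𝓡 n).tangent ∞
      (fun p : ℝ × (Fin n → ℝ) => (⟨1, (coordEquiv b).symm p.2⟩ : TangentBundle (𝓡 n) G)) := by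
    intro p
    refine contMDiffAt_totalSpace.2 ⟨contMDiffAt_const, ?_⟩
    simp only [trivializationAt_snd_of_proj_eq]
    exact ((coordEquiv b).symm.contDiff.comp contDiff_snd).contMDiff.contMDiffAt
  have h2 := hL.smooth.comp (contDiff_fst.contMDiff.prodMk h1)
  rw [show reducedLagrangian b L = _ from funext fun p => reducedLagrangian_eq b L p]
  exact contMDiff_iff_contDiff.1 h2

theorem isRegularInvariantLagrangian_invariantLagrangian {l : ℝ × (Fin n → ℝ) → ℝ}
    (hl : ContDiff ℝ ∞ l) (hdet : ∀ p, (hessian l p).det ≠ 0) :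
    IsRegularInvariantLagrangian (invariantLagrangian b l) where
  smooth := hl.contMDiff.comp
    (contMDiff_fst.prodMk_space ((contMDiff_mcForm b).comp contMDiff_snd))
  invariant t g v := congrArg (fun w => l (t, w)) (mcForm_mul b g v.1 v.2)
  regular t g v u h := by
    simp only [fderiv_fderiv_invariantLagrangian b hl] at h
    have h1 : Matrix.vecMul (mcForm b g u) (hessian l (t, mcForm b g v)) = 0 := by
      ext i
      obtain ⟨u', hu'⟩ := (mcForm_bijective b g).2 (Pi.single i 1)
      simpa [hu'] using h u'
    have h2 := Matrix.eq_zero_of_vecMul_eq_zero (hdet _) h1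
    exact (mcForm_bijective b g).1 (h2.trans (map_zero _).symm)

/-- At the identity, regularity says that the Hessian of the restriction is nondegenerate. -/
theorem IsRegularInvariantLagrangian.det_ne_zero {L : ℝ → TangentBundle (𝓡 n) G → ℝ}
    (hL : IsRegularInvariantLagrangian L) (p : ℝ × (Fin n → ℝ)) :
    (hessian (reducedLagrangian b L) p).det ≠ 0 := by
  intro h0
  obtain ⟨x, hx, hx0⟩ := Matrix.exists_vecMul_eq_zero_iff.2 h0
  obtain ⟨u, rfl⟩ := (mcForm_bijective b 1).2 x
  obtain ⟨v, hv⟩ := (mcForm_bijective b 1).2 p.2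
  refine hx ?_
  rw [hL.regular p.1 1 v u fun u' => ?_, map_zero]
  rw [eq_invariantLagrangian b hL.invariant,
    fderiv_fderiv_invariantLagrangian b (hL.contDiff_reducedLagrangian b), hv, hx0,
    zero_dotProduct]

/-- The velocity of a curve, in the chart at `g₀`. -/
theorem reducedVelocity_eq_chartForm {c : ℝ → G} {g₀ : G} {t : ℝ}
    (hc : ContMDiffAt 𝓘(ℝ, ℝ) (𝓡 n) 1 c t) (ht : c t ∈ (extChartAt (𝓡 n) g₀).source) :
    reducedVelocity b c t = chartForm b g₀ (extChartAt (𝓡 n) g₀ (c t))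
      (deriv (fun s => extChartAt (𝓡 n) g₀ (c s)) t) := by
  have hq : DifferentiableAt ℝ (fun s => extChartAt (𝓡 n) g₀ (c s)) t :=
    (((contMDiffAt_extChartAt' (n := 1) (by rwa [extChartAt_source] at ht)).comp t
      hc).contDiffAt).differentiableAt one_ne_zero
  have hφ : MDifferentiableAt 𝓘(ℝ, EuclideanSpace ℝ (Fin n)) (𝓡 n) (extChartAt (𝓡 n) g₀).symm
      (extChartAt (𝓡 n) g₀ (c t)) :=
    ((contMDiffOn_extChartAt_symm (n := ∞) g₀).mdifferentiableOn (by simp)).mdifferentiableAt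
      (extChartAt_target_mem_nhds' ((extChartAt (𝓡 n) g₀).map_source ht))
  have hev : c =ᶠ[𝓝 t] (extChartAt (𝓡 n) g₀).symm ∘ fun s => extChartAt (𝓡 n) g₀ (c s) := by
    filter_upwards [hc.continuousAt ((isOpen_extChartAt_source g₀).mem_nhds ht)] with s hs
    exact ((extChartAt (𝓡 n) g₀).left_inv hs).symm
  have h1 := hev.mfderiv_eq (I := 𝓘(ℝ, ℝ)) (I' := 𝓡 n)
  have h2 := mfderiv_comp t hφ hq.mdifferentiableAt
  have h3 : mfderiv 𝓘(ℝ, ℝ) 𝓘(ℝ, EuclideanSpace ℝ (Fin n))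
      (fun s => extChartAt (𝓡 n) g₀ (c s)) t (1 : ℝ)
        = deriv (fun s => extChartAt (𝓡 n) g₀ (c s)) t := by
    rw [mfderiv_eq_fderiv]
    rfl
  rw [reducedVelocity_eq, chartForm, (extChartAt (𝓡 n) g₀).left_inv ht]
  refine congrArg (mcForm b (c t)) ?_
  exact (congrArg (fun A => A (1 : ℝ)) (h1.trans h2)).trans
    (congrArg (mfderiv 𝓘(ℝ, EuclideanSpace ℝ (Fin n)) (𝓡 n) (extChartAt (𝓡 n) g₀).symm
      (extChartAt (𝓡 n) g₀ (c t))) h3)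

/-- The Euler–Lagrange equations of an invariant Lagrangian are the Euler–Poincaré equations of its
restriction to the Lie algebra. -/
theorem eulerLagrangeAt_invariantLagrangian_iff {l : ℝ × (Fin n → ℝ) → ℝ} (hl : ContDiff ℝ ∞ l)
    {c : ℝ → G} {t₀ : ℝ} (hc : ContMDiffAt 𝓘(ℝ, ℝ) (𝓡 n) 2 c t₀) :
    ∃ w', HasDerivAt (reducedVelocity b c) w' t₀ ∧
      (EulerLagrangeAt (invariantLagrangian b l) c t₀ ↔
        ∀ i, fderiv ℝ (pdw i l) (t₀, reducedVelocity b c t₀) (1, w')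
          = ∑ j, ∑ k, structureConstants b j i k * pdw k l (t₀, reducedVelocity b c t₀)
            * reducedVelocity b c t₀ j) := by
  let q : ℝ → EuclideanSpace ℝ (Fin n) := fun t => extChartAt (𝓡 n) (c t₀) (c t)
  have hq : ContDiffAt ℝ 2 q t₀ :=
    ((contMDiffAt_extChartAt (n := 2)).comp t₀ hc).contDiffAt
  have hq' : DifferentiableAt ℝ (deriv q) t₀ :=
    ((hq.fderiv_right (m := 1) (by norm_num)).clm_apply contDiffAt_const).differentiableAt
      one_ne_zero
  have hW : DifferentiableAt ℝ (chartForm b (c t₀)) (q t₀) :=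
    ((contDiffOn_chartForm b (c t₀)).contDiffAt (extChartAt_target_mem_nhds
      (c t₀))).differentiableAt (by simp)
  have hqd := hq.differentiableAt two_ne_zero
  have hw := (hW.hasFDerivAt.comp_hasDerivAt t₀ hqd.hasDerivAt).clm_apply hq'.hasDerivAt
  have hev : reducedVelocity b c =ᶠ[𝓝 t₀] fun t => chartForm b (c t₀) (q t) (deriv q t) := by
    filter_upwards [(contMDiffAt_iff_contMDiffAt_nhds (by simp)).1 (hc.of_le one_le_two),
      hc.continuousAt (extChartAt_source_mem_nhds (I := 𝓡 n) (c t₀))] with t h1 h2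
    exact reducedVelocity_eq_chartForm b h1 h2
  have key := eulerLagrange_iff_eulerPoincare hl hW
    (chartForm_bijective b (mem_extChartAt_target (c t₀))).2 (maurerCartanAt_chartForm b (c t₀))
    hqd hw
  refine ⟨_, hw.congr_of_eventuallyEq hev, ?_⟩
  rw [hev.self_of_nhds]
  exact key

/-- Every value of `w` and of its derivative is attained along a curve in `G`. -/
theorem exists_curve (t₀ : ℝ) (w₀ w₁ : Fin n → ℝ) :
    ∃ c : ℝ → G, ContMDiffAt 𝓘(ℝ, ℝ) (𝓡 n) 2 c t₀ ∧ reducedVelocity b c t₀ = w₀ ∧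
      HasDerivAt (reducedVelocity b c) w₁ t₀ := by
  let φ := extChartAt (𝓡 n) (1 : G)
  let x₀ := φ 1
  have hx₀ : x₀ ∈ φ.target := mem_extChartAt_target (1 : G)
  have hbij := chartForm_bijective b hx₀
  obtain ⟨v, hv⟩ := hbij.2 w₀
  obtain ⟨a, ha⟩ := hbij.2 (w₁ - fderiv ℝ (chartForm b 1) x₀ v v)
  -- a parabola in the chart with the prescribed velocity and acceleration
  let q : ℝ → EuclideanSpace ℝ (Fin n) := fun t => x₀ + (t - t₀) • v + ((t - t₀) ^ 2 / 2) • a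
  have hq : ContDiff ℝ 2 q := by fun_prop
  have hqt : q t₀ = x₀ := by simp [q]
  have hqd : ∀ t, HasDerivAt q (v + (t - t₀) • a) t := fun t => by
    have h1 : HasDerivAt (fun t => t - t₀) 1 t := (hasDerivAt_id t).sub_const t₀
    have h2 : HasDerivAt (fun t => (t - t₀) ^ 2 / 2) (t - t₀) t := by
      refine ((h1.fun_pow 2).div_const 2).congr_deriv ?_
      simp
    refine (((h1.smul_const v).const_add x₀).fun_add (h2.smul_const a)).congr_deriv ?_
    simp
  have hqtar : ∀ᶠ t in 𝓝 t₀, q t ∈ φ.target :=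
    hq.continuous.continuousAt (by rw [hqt]; exact extChartAt_target_mem_nhds (1 : G))
  have hφ : ContMDiffOn 𝓘(ℝ, EuclideanSpace ℝ (Fin n)) (𝓡 n) ∞ φ.symm φ.target :=
    contMDiffOn_extChartAt_symm (1 : G)
  have hc : ∀ᶠ t in 𝓝 t₀, ContMDiffAt 𝓘(ℝ, ℝ) (𝓡 n) 2 (fun t => φ.symm (q t)) t := by
    filter_upwards [hqtar] with t ht
    exact ((hφ.contMDiffAt (extChartAt_target_mem_nhds' ht)).of_le
      ENat.LEInfty.out).comp t hq.contMDiff.contMDiffAt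
  have hev : reducedVelocity b (fun t => φ.symm (q t))
      =ᶠ[𝓝 t₀] fun t => chartForm b 1 (q t) (v + (t - t₀) • a) := by
    filter_upwards [hc, hqtar, hqtar.eventually_nhds] with t h1 h2 h3
    rw [reducedVelocity_eq_chartForm b (h1.of_le one_le_two) (φ.map_target h2), φ.right_inv h2,
      Filter.EventuallyEq.deriv_eq (f := q) (h3.mono fun s hs => φ.right_inv hs), (hqd t).deriv]
  refine ⟨fun t => φ.symm (q t), hc.self_of_nhds, ?_, ?_⟩
  · rw [hev.self_of_nhds]
    simp [hqt, hv]
  · refine HasDerivAt.congr_of_eventuallyEq ?_ hev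
    have hW : DifferentiableAt ℝ (chartForm b (1 : G)) (q t₀) := by
      rw [hqt]
      exact ((contDiffOn_chartForm b (1 : G)).contDiffAt (extChartAt_target_mem_nhds
        (1 : G))).differentiableAt (by simp)
    have h1 : HasDerivAt (fun t => v + (t - t₀) • a) a t₀ := by
      simpa using (((hasDerivAt_id t₀).sub_const t₀).smul_const a).const_add v
    refine ((hW.hasFDerivAt.comp_hasDerivAt t₀ (hqd t₀)).clm_apply h1).congr_deriv ?_
    simp [hqt, ha]

theorem fderiv_pdw_eq_iff {l : ℝ × (Fin n → ℝ) → ℝ} {p : ℝ × (Fin n → ℝ)}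
    (hdet : (hessian l p).det ≠ 0) (w w' : Fin n → ℝ) :
    (∀ i, fderiv ℝ (pdw i l) p (1, w) = fderiv ℝ (pdw i l) p (1, w')) ↔ w = w' := by
  refine ⟨fun h => ?_, fun h i => by rw [h]⟩
  refine sub_eq_zero.1 (Matrix.eq_zero_of_vecMul_eq_zero hdet ?_)
  ext i
  have h1 : fderiv ℝ (pdw i l) p ((1, w) - (1, w')) = 0 := by rw [map_sub, h, sub_self]
  rw [Prod.mk_sub_mk, sub_self, fderiv_vertical] at h1
  exact h1

/-- An invariant Lagrangian with nondegenerate Hessian has the Euler–Lagrange equations given by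
`γ` exactly when the Euler–Poincaré expressions vanish. -/
theorem isDerivableFrom_invariantLagrangian_iff {γ : Fin n → ℝ × (Fin n → ℝ) → ℝ}
    {l : ℝ × (Fin n → ℝ) → ℝ} (hl : ContDiff ℝ ∞ l) (hdet : ∀ p, (hessian l p).det ≠ 0) :
    IsDerivableFrom b γ (invariantLagrangian b l) ↔
      ∀ i p, eulerPoincare (structureConstants b) γ l i p = 0 := by
  constructor
  · rintro ⟨-, h⟩ i ⟨t, w⟩
    obtain ⟨c, hc, rfl, hcd⟩ := exists_curve b t w fun i => γ i (t, w)
    obtain ⟨w', hw', hiff⟩ := eulerLagrangeAt_invariantLagrangian_iff b hl hc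
    have h1 := hiff.1 ((h c t hc).2 hcd) i
    rw [hw'.unique hcd] at h1
    exact sub_eq_zero.2 h1
  · intro hV
    refine ⟨isRegularInvariantLagrangian_invariantLagrangian b hl hdet, fun c t hc => ?_⟩
    obtain ⟨w', hw', hiff⟩ := eulerLagrangeAt_invariantLagrangian_iff b hl hc
    have hV' : ∀ i, ∑ j, ∑ k, structureConstants b j i k * pdw k l (t, reducedVelocity b c t)
        * reducedVelocity b c t j = fderiv ℝ (pdw i l) (t, reducedVelocity b c t)
          (1, fun i => γ i (t, reducedVelocity b c t)) := fun i =>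
      (sub_eq_zero.1 (hV i (t, reducedVelocity b c t))).symm
    rw [hiff]
    simp only [hV']
    rw [fderiv_pdw_eq_iff (hdet _)]
    exact ⟨fun h => hw'.congr_deriv h, fun h => hw'.unique h⟩

end Reduction

end

theorem mainTheorem3 {n : ℕ} {G : Type*} [TopologicalSpace G]
    [ChartedSpace (EuclideanSpace ℝ (Fin n)) G] [Group G] [LieGroup (𝓡 n) ∞ G]
    (b : Module.Basis (Fin n) ℝ (GroupLieAlgebra (𝓡 n) G))
    (γ : Fin n → ℝ × (Fin n → ℝ) → ℝ) (hγ : ∀ i, ContDiff ℝ ∞ (γ i)) :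
    (∀ k : ℝ × (Fin n → ℝ) → Matrix (Fin n) (Fin n) ℝ,
      IsReducedMultiplier (structureConstants b) γ k →
      (∃ l, IsPotential k l) ∧
      (∃! c₂ : ℝ → LieH2 ℝ (GroupLieAlgebra (𝓡 n) G) (TrivR (GroupLieAlgebra (𝓡 n) G)),
        IsH2Class b γ k c₂) ∧
      (IsH2Class b γ k (fun _ => 0) →
        (∀ l μ ν, IsPotential k l → IsResidual b γ l μ ν →
          (∃ θ, IsPrimitive μ θ) ∧ ∀ θ, IsPrimitive μ θ → ∃! c₁, IsH1Class ν θ c₁) ∧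
        (∀ l μ ν θ c₁ l' μ' ν' θ' c₁',
          IsPotential k l → IsResidual b γ l μ ν → IsPrimitive μ θ → IsH1Class ν θ c₁ →
          IsPotential k l' → IsResidual b γ l' μ' ν' → IsPrimitive μ' θ' → IsH1Class ν' θ' c₁' →
          ∃ η ζ : ℝ → LieZ1 ℝ (GroupLieAlgebra (𝓡 n) G) (TrivR (GroupLieAlgebra (𝓡 n) G)),
            SmoothOneCurve (fun t => (η t).1) ∧
            (∀ t x, HasDerivAt (fun s => ((η s).1 x).val) ((ζ t).1 x).val t) ∧
            ∀ t, c₁' t = c₁ t + Submodule.Quotient.mk (ζ t)) ∧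
        (∀ l μ ν θ, IsPotential k l → IsResidual b γ l μ ν → IsPrimitive μ θ →
          IsH1Class ν θ (fun _ => 0) →
          ∃ L, IsDerivableFrom b γ L ∧ IsPotential k (reducedLagrangian b L)))) ∧
    (∀ L, IsDerivableFrom b γ L →
      ∃ k, IsPotential k (reducedLagrangian b L) ∧
        IsReducedMultiplier (structureConstants b) γ k ∧
        IsH2Class b γ k (fun _ => 0) ∧
        ∀ l μ ν, IsPotential k l → IsResidual b γ l μ ν →
          ∃ θ, IsPrimitive μ θ ∧ IsH1Class ν θ (fun _ => 0)) := by
  refine ⟨fun k hk => ⟨exists_isPotential hk.smooth hk.symm hk.deriv_symm,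
    hk.existsUnique_isH2Class hγ, fun hc => ⟨fun l μ ν hl h => ⟨?_, fun θ hθ =>
      hθ.existsUnique_isH1Class hγ hk hl h⟩, ?_, fun l μ ν θ hl h hθ h1 => ?_⟩⟩, fun L hL => ?_⟩
  · exact exists_isPrimitive b h.smooth_two fun t => hc.mk_eq hl h t
  · intro l μ ν θ c₁ l' μ' ν' θ' c₁' hl h hθ h1 hl' h' hθ' h1'
    exact h1.exists_velocity hl h hθ hl' h' hθ' h1'
  · obtain ⟨l', hl', hV⟩ := exists_eulerPoincare_eq_zero hl h hθ h1
    refine ⟨invariantLagrangian b l',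
      (isDerivableFrom_invariantLagrangian_iff b hl'.1 fun p => ?_).2 hV, ?_⟩
    · rw [hl'.2 p]
      exact hk.det_ne_zero p
    · rwa [reducedLagrangian_invariantLagrangian]
  · have hl := hL.lagrangian.contDiff_reducedLagrangian b
    have hdet := hL.lagrangian.det_ne_zero b
    have hV : ∀ i p,
        eulerPoincare (structureConstants b) γ (reducedLagrangian b L) i p = 0 := by
      rw [eq_invariantLagrangian b hL.lagrangian.invariant] at hL
      exact (isDerivableFrom_invariantLagrangian_iff b hl hdet).1 hL
    have hpot : IsPotential (hessian (reducedLagrangian b L)) (reducedLagrangian b L) :=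
      ⟨hl, fun _ => rfl⟩
    exact ⟨_, hpot, isReducedMultiplier_of_eulerPoincare_eq_zero
      (isLieConstants_structureConstants b) hγ hl hdet hV,
      exists_primitive_of_eulerPoincare_eq_zero hpot hV⟩
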